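/- Let $H$ be a real separable Hilbert space and let $A,B$ be non-negative definite trace-class operators on $H$. A Green's operator for $A$ is a Hilbert–Schmidt operator $G$ with $GG^*=A$. Assume that $B$ is reachable from $A$, i.e. there is a (possibly unbounded) linear operator $T$ defined on the range of $A^{1/2}$ with $(TA^{1/2})(TA^{1/2})^*=B$ and $\operatorname{tr}(TA)=\operatorname{tr}[(A^{1/2}BA^{1/2})^{1/2}]$. *Entropic coupling.* Fix any Green's operators $G$ for $A$ and $M$ for $B$. Let $\mathcal F(G,M)$ be the set of Hilbert–Schmidt operators $R$ with $\ker R\supset\ker M$, $\operatorname{ran}R\subset(\ker G)^\perp$ and $\|R\|_{op}<1$. For $\varepsilon>0$ let $R_\varepsilon$ be the maximizer over $R\in\mathcal F(G,M)$ of $$2\operatorname{tr}(RM^*G)+\varepsilon\log\det(I-R^*R),$$ where $\det$ is the Fredholm determinant. Put $C_\varepsilon=GR_\varepsilon M^*$, the EOT cross-covariance, and let $\pi_\varepsilon=\mathcal N(0,\Sigma_\varepsilon)$ be the Gaussian EOT coupling, a measure on $H\times H$ with $\Sigma_\varepsilon=\begin{pmatrix}A&C_\varepsilon\\C_\varepsilon^*&B\end{pmatrix}$.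 *Canonical coupling.* Write $H=H_1\oplus H_2$ with $H_1=\overline{\operatorname{ran}A}$, $H_2=\ker A$, and $A_{11},B_{ij}$ for the corresponding blocks. Put $P_{11}=A_{11}^{1/2}B_{11}A_{11}^{1/2}$, and let $B/A$ be the restriction to $H_2$ of $B^{1/2}\Pi B^{1/2}$, with $\Pi$ the orthogonal projection onto $\ker(A^{1/2}B^{1/2})$. With $\dagger$ the Moore–Penrose pseudoinverse (and $X^{\dagger/2}=(X^{1/2})^\dagger$), let $$G_0=A^{1/2},\qquad M_0=\begin{pmatrix}A_{11}^{\dagger/2}P_{11}^{1/2}&0\\ [P_{11}^{\dagger/2}A_{11}^{1/2}B_{12}]^*&(B/A)^{1/2}\end{pmatrix},\qquad C_0=G_0M_0^*,$$ and let $\pi_0=\mathcal N(0,\Sigma_0)$ with $\Sigma_0=\begin{pmatrix}A&C_0\\C_0^*&B\end{pmatrix}$. Then: 1. $G_0$ and $M_0$ are Green's operators for $A$ and $B$ and are properly aligned ($G_0^*M_0$ is non-negative definite and trace class), $C_0$ is trace class, $\Sigma_0$ is the covariance of a Gaussian measure $\pi_0$, and $\pi_0$ is an optimal coupling of $\mathcal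 N(0,A)$ and $\mathcal N(0,B)$ for the quadratic cost $\|x-y\|^2$. 2. For every $\varepsilon>0$ the maximizer $R_\varepsilon$ exists and is unique, $C_\varepsilon$ is trace class, and $\Sigma_\varepsilon$ is the covariance of a Gaussian measure $\pi_\varepsilon$. 3. As $\varepsilon\downarrow0$, $C_\varepsilon\to C_0$ in trace norm. 4. Consequently $\lim_{\varepsilon\downarrow0}W_2(\pi_\varepsilon,\pi_0)=0$, where $W_2$ is the 2-Wasserstein distance on $H\times H$. -/

import Mathlib

open MeasureTheory ProbabilityTheory Filter Topology
open scoped ENNReal InnerProduct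

noncomputable section

namespace GaussEOT

section Operators

variable {H : Type*} [NormedAddCommGroup H] [InnerProductSpace ℝ H] [CompleteSpace H]

/-- The index set of a fixed orthonormal basis of `H`. -/
def basisIndex (H : Type*) [NormedAddCommGroup H] [InnerProductSpace ℝ H] [CompleteSpace H] :
    Set H :=
  (exists_hilbertBasis ℝ H).choose

/-- A fixed orthonormal basis of `H`.  Traces and Schatten norms do not depend on it. -/
def basis (H : Type*) [NormedAddCommGroup H] [InnerProductSpace ℝ H] [CompleteSpace H] :
    HilbertBasis (basisIndex H) ℝ H :=
  (exists_hilbertBasis ℝ H).choose_spec.choose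

open Classical in
/-- The non-negative square root `T^{1/2}` of a bounded non-negative definite operator
(and `0` for an operator that has no non-negative square root). -/
def opSqrt (T : H →L[ℝ] H) : H →L[ℝ] H :=
  if h : ∃ S : H →L[ℝ] H, S.IsPositive ∧ S ∘L S = T then h.choose else 0

/-- The trace norm `‖T‖₁ = ∑ ⟨e_l, (T*T)^{1/2} e_l⟩`, with value `∞` if `T` is not trace class. -/
def traceNorm (T : H →L[ℝ] H) : ℝ≥0∞ :=
  ∑' i, ENNReal.ofReal (inner ℝ (basis H i) (opSqrt (T† ∘L T) (basis H i)))

/-- `T` is trace class (a bounded operator with finite trace norm is automatically compact). -/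
def IsTraceClass (T : H →L[ℝ] H) : Prop := traceNorm T < ∞

/-- `T` is Hilbert–Schmidt: `∑ ⟨e_l, T*T e_l⟩ = ∑ ‖T e_l‖² < ∞`. -/
def IsHilbertSchmidt (T : H →L[ℝ] H) : Prop :=
  ∑' i, ENNReal.ofReal (‖T (basis H i)‖ ^ 2) < ∞

/-- The trace of a trace class operator. -/
def trace (T : H →L[ℝ] H) : ℝ := ∑' i, inner ℝ (basis H i) (T (basis H i))

/-- Covariance operators: the non-negative definite trace class operators. -/
def IsCovariance (A : H →L[ℝ] H) : Prop := A.IsPositive ∧ IsTraceClass A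

/-- The Fredholm determinant `det(I + K)` of a self-adjoint trace class operator `K`: the product
of `1 + κ` over the eigenvalues `κ` of `K`, each repeated according to its multiplicity
(the factor of `κ = 0` is `1`, whatever the dimension of the kernel). -/
def fredholmDet (K : H →L[ℝ] H) : ℝ :=
  ∏' κ : ℝ, (1 + κ) ^ Module.finrank ℝ (Module.End.eigenspace (K : H →ₗ[ℝ] H) κ)

/-- `G` is a Green's operator for `A`. -/
def IsGreen (A G : H →L[ℝ] H) : Prop := IsHilbertSchmidt G ∧ G ∘L G† = A

/-- `G` and `M` are properly aligned: `G* M` is non-negative definite and trace class. -/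
def ProperlyAligned (G M : H →L[ℝ] H) : Prop := IsCovariance (G† ∘L M)

/-- `P = A^{1/2} B A^{1/2}`. -/
def opP (A B : H →L[ℝ] H) : H →L[ℝ] H := opSqrt A ∘L B ∘L opSqrt A

/-- `B` is reachable from `A`: there is a (possibly unbounded) operator `T`, defined on the range
of `A^{1/2}`, with `(T A^{1/2}) (T A^{1/2})* = B` and `tr (T A) = tr ((A^{1/2} B A^{1/2})^{1/2})`.
Here `X` is `T A^{1/2}`, so that `T A = X A^{1/2}`. -/
def Reachable (A B : H →L[ℝ] H) : Prop :=
  ∃ (T : (opSqrt A).range →ₗ[ℝ] H) (X : H →L[ℝ] H),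
    (∀ x : H, X x = T ⟨opSqrt A x, LinearMap.mem_range_self _ x⟩) ∧
    X ∘L X† = B ∧
    trace (X ∘L opSqrt A) = trace (opSqrt (opP A B))

/-! ### The entropic problem -/

/-- The set of admissible Green's correlation operators. -/
def admissible (G M : H →L[ℝ] H) : Set (H →L[ℝ] H) :=
  {R | IsHilbertSchmidt R ∧ M.ker ≤ R.ker ∧ R.range ≤ G.kerᗮ ∧ ‖R‖ < 1}

/-- The entropic profit `2 tr (R M* G) + ε log det (I - R* R)`. -/
def profit (G M : H →L[ℝ] H) (ε : ℝ) (R : H →L[ℝ] H) : ℝ :=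
  2 * trace (R ∘L M† ∘L G) + ε * Real.log (fredholmDet (-(R† ∘L R)))

/-- `R` maximizes the entropic profit over the admissible Green's correlation operators. -/
def IsOptimalCorrelation (G M : H →L[ℝ] H) (ε : ℝ) (R : H →L[ℝ] H) : Prop :=
  R ∈ admissible G M ∧ IsMaxOn (profit G M ε) (admissible G M) R

/-! ### The canonical Green's operator

Write `H = H₁ ⊕ H₂`, where `H₁` is the closure of the range of `A` and `H₂` is the kernel of `A`.
An operator between `H₁` and `H₂` is identified with its extension by zero to `H`. -/

open Classical in
/-- The Moore–Penrose pseudoinverse `T†`, evaluated at `y`: the unique `x` orthogonal to the kernel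
of `T` such that `T x` is the orthogonal projection of `y` onto the closure of the range of `T`
(and `0` if `y` is outside of the domain of `T†`). -/
def pinv (T : H →L[ℝ] H) (y : H) : H :=
  if h : ∃ x ∈ T.kerᗮ, T x = T.range.topologicalClosure.starProjection y then h.choose else 0

open Classical in
/-- The composition of the pseudoinverse of `T` with `S`, as a bounded operator
(and `0` if it is not bounded). -/
def pinvComp (T S : H →L[ℝ] H) : H →L[ℝ] H :=
  if h : ∃ X : H →L[ℝ] H, ∀ x, X x = pinv T (S x) then h.choose else 0

/-- The `A`-Schur operator `B/A = B^{1/2} Π B^{1/2}`, with `Π` the orthogonal projection onto the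
kernel of `A^{1/2} B^{1/2}`.  It vanishes on `H₁` and leaves `H₂` invariant. -/
def schur (A B : H →L[ℝ] H) : H →L[ℝ] H :=
  opSqrt B ∘L (opSqrt A ∘L opSqrt B).ker.starProjection ∘L opSqrt B

/-- The canonical Green's operator `M₀` for `B`, with blocks `A₁₁^{†/2} P₁₁^{1/2}` and `0` in the
first row, `[P₁₁^{†/2} A₁₁^{1/2} B₁₂]*` and `(B/A)^{1/2}` in the second row. -/
def canonicalM (A B : H →L[ℝ] H) : H →L[ℝ] H :=
  pinvComp (opSqrt A) (opSqrt (opP A B))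
    + (pinvComp (opSqrt (opP A B)) (opSqrt A ∘L B ∘L A.ker.starProjection))†
    + opSqrt (schur A B)

/-- The canonical cross-covariance `C₀ = G₀ M₀*`, where `G₀ = A^{1/2}`. -/
def canonicalC (A B : H →L[ℝ] H) : H →L[ℝ] H := opSqrt A ∘L (canonicalM A B)†

/-- The block operator with rows `(A, C)` and `(C*, B)` on the Hilbert space `H × H`. -/
def blockCov (A C B : H →L[ℝ] H) : WithLp 2 (H × H) →L[ℝ] WithLp 2 (H × H) :=
  (WithLp.prodContinuousLinearEquiv 2 ℝ H H).symm.toContinuousLinearMap ∘L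
    ((A.coprod C).prod ((C†).coprod B)) ∘L
      (WithLp.prodContinuousLinearEquiv 2 ℝ H H).toContinuousLinearMap

end Operators

section Measures

/-- `μ` is the centered Gaussian measure `N(0, S)`. -/
def IsCenteredGaussian {E : Type*} [NormedAddCommGroup E] [InnerProductSpace ℝ E]
    [MeasurableSpace E] [BorelSpace E] (μ : Measure E) (S : E →L[ℝ] E) : Prop :=
  IsGaussian μ ∧ ∫ x, x ∂μ = 0 ∧ ∀ u v : E, covarianceBilin μ u v = inner ℝ u (S v)

/-- The couplings of `μ` and `ν`. -/
def couplings {E : Type*} [MeasurableSpace E] (μ ν : Measure E) : Set (Measure (E × E)) :=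
  {γ | γ.map Prod.fst = μ ∧ γ.map Prod.snd = ν}

/-- The quadratic transport cost `∫ ‖x - y‖² dγ`. -/
def quadCost {E : Type*} [NormedAddCommGroup E] [MeasurableSpace E] (γ : Measure (E × E)) : ℝ≥0∞ :=
  ∫⁻ p, ENNReal.ofReal (‖p.1 - p.2‖ ^ 2) ∂γ

/-- The 2-Wasserstein distance. -/
def W2 {E : Type*} [NormedAddCommGroup E] [MeasurableSpace E] (μ ν : Measure E) : ℝ≥0∞ :=
  (⨅ γ ∈ couplings μ ν, quadCost γ) ^ (1 / 2 : ℝ)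

/-- `γ` solves the Kantorovich problem with quadratic cost between `μ` and `ν`. -/
def IsOptimalCoupling {E : Type*} [NormedAddCommGroup E] [MeasurableSpace E]
    (μ ν : Measure E) (γ : Measure (E × E)) : Prop :=
  γ ∈ couplings μ ν ∧ IsMinOn quadCost (couplings μ ν) γ

end Measures

end GaussEOT

end

namespace GaussEOT

/-! ### Hilbert bases and diagonal operators -/

section HilbertBases

variable {H : Type*} [NormedAddCommGroup H] [InnerProductSpace ℝ H]

/-! The entropic problem is solved explicitly in one orthonormal basis. Diagonalize the compact
positive operator M*GG*M by a basis f with eigenvalues l_i, so that the vectors k_i = G*M f_i are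
orthogonal with ‖k_i‖² = l_i. In this basis the trace term of the profit is 2 ∑ ⟨k_i, R f_i⟩, and
Jensen's inequality gives log det(I - R*R) ≤ ∑ log(1 - ‖R f_i‖²), with equality when f diagonalizes
R*R. The problem thus decouples into concave problems in the vectors z = R f_i: maximize 2⟨k_i, z⟩ +
ε log(1 - ‖z‖²). The maximizer is c k_i with l_i c² + ε c = 1. These values define an operator
diagonalized by f, so the bound is attained, and strong concavity yields a profit gap of at least ε
∑ ‖R' f_i - R f_i‖², hence uniqueness (`logBarrier_le`, `log_fredholmDet_neg_le`,
`IsShrunk.profit_gap`).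

As ε ↓ 0, √l c → 1 for each l > 0, so R_ε f_i → W f_i, where W is the partial isometry in the polar
decomposition of G*M. The convergence need not be uniform in i, but R_ε - W = W N with N diagonal,
bounded by 1 and tending to 0 entrywise. Since M is Hilbert–Schmidt, dominated convergence sends
(R_ε - W)M* to 0 in Hilbert–Schmidt norm, and Hölder's inequality with G gives trace norm
convergence to G W M* (`tendsto_traceNorm`).

This limit does not depend on G and M. Write a = A^{1/2}, b = B^{1/2}, P = aBa, and let V be the
partial isometry with V b a = P^{1/2}. The block formula for M₀ collapses to b V* + (B/A)^{1/2},
hence C₀ = a V b. Since G* and M* are partial isometries applied to a and b, uniqueness of the polar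
decomposition gives G W M* = a V b (`IsLimitCorrelation.comp_eq_canonicalC`).

For the measures, all the block covariances are factored over a common index set, using M(I -
R*R)^{1/2} for the part of B not explained by R. Driving the resulting Gaussian series by the same
independent variables bounds W₂ by an ℓ² distance of coefficients, again controlled by dominated
convergence (`W2_gaussLaw_le`, `tendsto_W2`). Finally, every coupling has cross-covariance a K b
with K a contraction, and tr(a K b) ≤ tr P^{1/2} = tr(a V b), which makes π₀ optimal
(`trace_correlation_le`). -/

theorem hasSum_inner_sq {ι : Type*} (b : HilbertBasis ι ℝ H) (x : H) :
    HasSum (fun i => inner ℝ (b i) x ^ 2) (‖x‖ ^ 2) := by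
  have h := b.hasSum_inner_mul_inner x x
  rw [real_inner_self_eq_norm_sq] at h
  simpa only [real_inner_comm x, ← sq] using h

theorem tsum_ofReal_inner_sq {ι : Type*} (b : HilbertBasis ι ℝ H) (x : H) :
    ∑' i, ENNReal.ofReal (inner ℝ (b i) x ^ 2) = ENNReal.ofReal (‖x‖ ^ 2) := by
  rw [← (hasSum_inner_sq b x).tsum_eq,
    ENNReal.ofReal_tsum_of_nonneg (fun i => sq_nonneg _) (hasSum_inner_sq b x).summable]

theorem ext_inner_basis {ι : Type*} (b : HilbertBasis ι ℝ H) {x y : H}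
    (h : ∀ i, inner ℝ (b i) x = inner ℝ (b i) y) : x = y := by
  apply b.repr.injective
  ext i
  simpa [b.repr_apply_apply] using h i

theorem clm_ext_basis {ι F : Type*} [NormedAddCommGroup F] [NormedSpace ℝ F]
    (b : HilbertBasis ι ℝ H) {S T : H →L[ℝ] F}
    (h : ∀ i, S (b i) = T (b i)) : S = T := by
  refine ContinuousLinearMap.ext_on (s := Set.range b) ?_ ?_
  · rw [dense_iff_closure_eq, ← Submodule.topologicalClosure_coe, b.dense_span]; rfl
  · rintro _ ⟨i, rfl⟩; exact h i

theorem inner_basis_self {ι : Type*} (b : HilbertBasis ι ℝ H) (i : ι) :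
    inner ℝ (b i) (b i) = 1 := by
  rw [real_inner_self_eq_norm_sq, b.orthonormal.1 i, one_pow]

theorem inner_basis_of_ne {ι : Type*} (b : HilbertBasis ι ℝ H) {i j : ι} (h : i ≠ j) :
    inner ℝ (b i) (b j) = 0 := b.orthonormal.2 h

/-- The operator that is diagonal in the basis `b`, with bounded diagonal `d`. -/
theorem exists_diagonal {ι : Type*} (b : HilbertBasis ι ℝ H) (d : ι → ℝ) (C : ℝ)
    (hd : ∀ i, |d i| ≤ C) :
    ∃ D : H →L[ℝ] H, (∀ i x, inner ℝ (b i) (D x) = d i * inner ℝ (b i) x) ∧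
      (∀ i, D (b i) = d i • b i) := by
  have hbd : ∀ x i, d i ^ 2 * inner ℝ (b i) x ^ 2 ≤ C ^ 2 * inner ℝ (b i) x ^ 2 := fun x i => by
    have : d i ^ 2 ≤ C ^ 2 := by
      rw [← sq_abs (d i)]; exact pow_le_pow_left₀ (abs_nonneg _) (hd i) 2
    gcongr
  have hs : ∀ x, Summable fun i => d i ^ 2 * inner ℝ (b i) x ^ 2 := fun x =>
    Summable.of_nonneg_of_le (fun i => by positivity) (hbd x)
      ((hasSum_inner_sq b x).summable.mul_left _)
  have hmem : ∀ x, Memℓp (fun i => d i * inner ℝ (b i) x) 2 := fun x => by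
    apply memℓp_gen
    simpa [mul_pow] using hs x
  let f : H →ₗ[ℝ] H :=
    { toFun := fun x => b.repr.symm ⟨fun i => d i * inner ℝ (b i) x, hmem x⟩
      map_add' := fun x y => by
        rw [← map_add]; congr 1; ext i
        simp [inner_add_right, mul_add]; rfl
      map_smul' := fun c x => by
        rw [RingHom.id_apply, ← map_smul]; congr 1; ext i
        simp [inner_smul_right]; ring }
  have hf : ∀ x i, inner ℝ (b i) (f x) = d i * inner ℝ (b i) x := fun x i => by
    rw [← b.repr_apply_apply]
    simp [f]
  let D : H →L[ℝ] H := f.mkContinuous |C| fun x => by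
    refine abs_le_of_sq_le_sq' ?_ (by positivity) |>.2
    rw [← (hasSum_inner_sq b (f x)).tsum_eq, mul_pow, sq_abs, ← (hasSum_inner_sq b x).tsum_eq,
      ← tsum_mul_left]
    simp only [hf, mul_pow]
    exact Summable.tsum_le_tsum (hbd x) (hs x) ((hasSum_inner_sq b x).summable.mul_left _)
  refine ⟨D, fun i x => hf x i, fun i => ext_inner_basis b fun j => ?_⟩
  rw [inner_smul_right]
  refine (hf (b i) j).trans ?_
  rcases eq_or_ne j i with rfl | h
  · rfl
  · simp [inner_basis_of_ne b h]

end HilbertBases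

/-! ### Eigenbases and partial isometries -/

section Spectral

universe u

variable {H : Type u} [NormedAddCommGroup H] [InnerProductSpace ℝ H] [CompleteSpace H]

/-- A compact symmetric operator has an orthonormal basis of eigenvectors. -/
theorem exists_eigenbasis {T : H →L[ℝ] H} (hT : IsCompactOperator T)
    (hT' : (T : H →ₗ[ℝ] H).IsSymmetric) :
    ∃ (ι : Type u) (b : HilbertBasis ι ℝ H) (d : ι → ℝ), ∀ i, T (b i) = d i • b i := by
  have key : ∀ μ : ℝ, ∃ (w : Set (Module.End.eigenspace (T : H →ₗ[ℝ] H) μ))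
      (c : HilbertBasis w ℝ (Module.End.eigenspace (T : H →ₗ[ℝ] H) μ)), ⇑c = ((↑) : w → _) := by
    intro μ
    have : IsClosed (Module.End.eigenspace (T : H →ₗ[ℝ] H) μ : Set H) := by
      have : (Module.End.eigenspace (T : H →ₗ[ℝ] H) μ : Set H) = {x | T x = μ • x} := by
        ext x; simp
      rw [this]
      exact isClosed_eq T.continuous (continuous_const_smul μ)
    have := this.completeSpace_coe
    exact exists_hilbertBasis ℝ _
  choose w c hc using key
  let v : (Σ μ : ℝ, w μ) → H := fun a =>
    ((c a.1 a.2 : Module.End.eigenspace (T : H →ₗ[ℝ] H) a.1) : H)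
  have ho : Orthonormal ℝ v := hT'.orthogonalFamily_eigenspaces.orthonormal_sigma_orthonormal
    (v_family := fun μ => (c μ : w μ → _)) (fun μ => (c μ).orthonormal)
  -- A vector orthogonal to the chosen bases is orthogonal to every eigenspace, by expansion inside
  -- that eigenspace, and the eigenspaces of a compact symmetric operator are total.
  have horth : (Submodule.span ℝ (Set.range v))ᗮ = ⊥ := by
    rw [eq_bot_iff, ← ContinuousLinearMap.orthogonalComplement_iSup_eigenspaces_eq_bot hT hT',
      ← Submodule.iInf_orthogonal]
    intro x hx
    rw [Submodule.mem_iInf]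
    intro μ y hy
    have h := ((c μ).hasSum_repr ⟨y, hy⟩).mapL
      ((innerSL ℝ x).comp (Module.End.eigenspace (T : H →ₗ[ℝ] H) μ).subtypeL)
    have h0 : ∀ i, inner ℝ x (c μ i : H) = 0 := fun i => by
      rw [real_inner_comm]
      exact hx _ (Submodule.subset_span ⟨⟨μ, i⟩, rfl⟩)
    simp only [map_smul, ContinuousLinearMap.comp_apply, Submodule.subtypeL_apply,
      innerSL_apply_apply, h0, smul_zero] at h
    rw [real_inner_comm]
    exact (hasSum_zero.unique h).symm
  refine ⟨_, HilbertBasis.mkOfOrthogonalEqBot ho horth, fun a => a.1, fun a => ?_⟩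
  rw [HilbertBasis.coe_mkOfOrthogonalEqBot]
  exact Module.End.mem_eigenspace_iff.1 (c a.1 a.2).2

/-- Factorization through the initial space of a partial isometry. -/
theorem exists_partialIsometry {F F' : Type*} [NormedAddCommGroup F] [InnerProductSpace ℝ F]
    [CompleteSpace F] [NormedAddCommGroup F'] [InnerProductSpace ℝ F'] [CompleteSpace F']
    (X : H →L[ℝ] F) (Y : H →L[ℝ] F') (h : ∀ x, ‖X x‖ = ‖Y x‖) :
    ∃ W : F' →L[ℝ] F, (∀ x, W (Y x) = X x) ∧ (∀ x, (W†) (X x) = Y x) ∧ (∀ z, ‖W z‖ ≤ ‖z‖) ∧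
      (∀ z, (Y†) z = 0 → W z = 0) := by
  let U := (Y : H →ₗ[ℝ] F').range.topologicalClosure
  have hU : IsClosed (U : Set F') := Submodule.isClosed_topologicalClosure _
  have : CompleteSpace U := hU.completeSpace_coe
  let e : H →ₗ[ℝ] U := (Y : H →ₗ[ℝ] F').codRestrict U fun x =>
    Submodule.le_topologicalClosure _ (LinearMap.mem_range_self _ x)
  have he : DenseRange e := by
    intro z
    rw [Topology.IsInducing.subtypeVal.closure_eq_preimage_closure_image]
    have : (Subtype.val '' Set.range e : Set F') = Set.range Y := by
      rw [← Set.range_comp]; rfl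
    have hz : (z : F') ∈ closure (Set.range Y) := z.2
    rw [← this] at hz
    exact hz
  have hn : ∀ x, ‖(X : H →ₗ[ℝ] F) x‖ ≤ 1 * ‖e x‖ := fun x => by
    rw [one_mul]; exact (h x).le
  -- The map Y x ↦ X x is isometric, so it extends to the closure U of the range of Y; composing
  -- with the projection onto U makes it vanish on the complement.
  let W : F' →L[ℝ] F := ((X : H →ₗ[ℝ] F).extendOfNorm e).comp U.orthogonalProjectionOnto
  have hW : ∀ x, W (Y x) = X x := fun x => by
    have : U.orthogonalProjectionOnto (Y x) = e x :=
      Submodule.orthogonalProjectionOnto_mem_subspace_eq_self (e x)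
    change (X : H →ₗ[ℝ] F).extendOfNorm e (U.orthogonalProjectionOnto (Y x)) = X x
    rw [this]
    exact LinearMap.extendOfNorm_eq he ⟨1, hn⟩ x
  have hW0 : ∀ z ∈ Uᗮ, W z = 0 := fun z hz => by
    change (X : H →ₗ[ℝ] F).extendOfNorm e (U.orthogonalProjectionOnto z) = 0
    rw [(Submodule.orthogonalProjectionOnto_eq_zero_iff).2 hz, map_zero]
  have hWz : ∀ z, (Y†) z = 0 → W z = 0 := fun z hz => by
    apply hW0
    change z ∈ ((Y : H →ₗ[ℝ] F').range.topologicalClosure)ᗮ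
    rw [Submodule.orthogonal_closure]
    rintro _ ⟨x, rfl⟩
    change inner ℝ (Y x) z = 0
    rw [← ContinuousLinearMap.adjoint_inner_right, hz, inner_zero_right]
  refine ⟨W, hW, fun x => ?_, fun z => ?_, hWz⟩
  -- Both W* X x and Y x lie in U, and they have the same inner products with the range of Y because
  -- X and Y have the same Gram form. Their difference lies in U ∩ Uᗮ.
  · have h1 : (W†) (X x) ∈ U := by
      rw [← hU.submodule_topologicalClosure_eq, ← Submodule.orthogonal_orthogonal_eq_closure]
      intro z hz
      rw [ContinuousLinearMap.adjoint_inner_right, hW0 z hz, inner_zero_left]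
    have h2 : (W†) (X x) - Y x ∈ U :=
      U.sub_mem h1 (Submodule.le_topologicalClosure _ (LinearMap.mem_range_self _ x))
    have hp : ∀ x y, inner ℝ (X x) (X y) = inner ℝ (Y x) (Y y) := fun x y => by
      rw [real_inner_eq_norm_add_mul_self_sub_norm_mul_self_sub_norm_mul_self_div_two,
        real_inner_eq_norm_add_mul_self_sub_norm_mul_self_sub_norm_mul_self_div_two, ← map_add,
        ← map_add, h, h, h]
    have h3 : (W†) (X x) - Y x ∈ Uᗮ := by
      change _ ∈ ((Y : H →ₗ[ℝ] F').range.topologicalClosure)ᗮ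
      rw [Submodule.orthogonal_closure]
      rintro _ ⟨y, rfl⟩
      change inner ℝ (Y y) _ = 0
      rw [inner_sub_right, ContinuousLinearMap.adjoint_inner_right, hW, hp, sub_self]
    exact sub_eq_zero.1 (inner_self_eq_zero (𝕜 := ℝ).1 (h3 _ h2))
  · refine (LinearMap.norm_extendOfNorm_apply_le he 1 hn _).trans ?_
    rw [one_mul]
    exact Submodule.norm_orthogonalProjectionOnto_apply_le U z

end Spectral

/-! ### Hilbert–Schmidt operators and the trace of a product -/

section HilbertSchmidt

universe u

variable {H : Type u} [NormedAddCommGroup H] [InnerProductSpace ℝ H] [CompleteSpace H]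

/-- The square of the Hilbert–Schmidt norm. -/
noncomputable def hsSq (T : H →L[ℝ] H) : ℝ≥0∞ := ∑' i, ENNReal.ofReal (‖T (basis H i)‖ ^ 2)

/-- Parseval on both sides and an exchange of nonnegative sums. Since the two bases are unrelated,
passing through the adjoint also gives independence of the basis. -/
theorem tsum_norm_sq_adjoint {ι κ : Type*} (b : HilbertBasis ι ℝ H) (c : HilbertBasis κ ℝ H)
    (T : H →L[ℝ] H) :
    ∑' i, ENNReal.ofReal (‖T (b i)‖ ^ 2) = ∑' k, ENNReal.ofReal (‖(T†) (c k)‖ ^ 2) := by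
  simp_rw [← tsum_ofReal_inner_sq c (T _), ← tsum_ofReal_inner_sq b ((T†) _)]
  rw [ENNReal.tsum_comm]
  simp_rw [ContinuousLinearMap.adjoint_inner_right, real_inner_comm (T _)]

theorem hsSq_adjoint (T : H →L[ℝ] H) : hsSq (T†) = hsSq T :=
  (tsum_norm_sq_adjoint (basis H) (basis H) T).symm

theorem tsum_norm_sq {ι : Type*} (b : HilbertBasis ι ℝ H) (T : H →L[ℝ] H) :
    ∑' i, ENNReal.ofReal (‖T (b i)‖ ^ 2) = hsSq T :=
  (tsum_norm_sq_adjoint b (basis H) T).trans (hsSq_adjoint T)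

theorem hsSq_comp_le (S T : H →L[ℝ] H) : hsSq (S ∘L T) ≤ ENNReal.ofReal (‖S‖ ^ 2) * hsSq T := by
  unfold hsSq
  rw [← ENNReal.tsum_mul_left]
  refine ENNReal.tsum_le_tsum fun i => ?_
  rw [← ENNReal.ofReal_mul (by positivity), ← mul_pow]
  refine ENNReal.ofReal_le_ofReal (pow_le_pow_left₀ (norm_nonneg _) ?_ 2)
  exact S.le_opNorm _

theorem hsSq_comp_le' (S T : H →L[ℝ] H) : hsSq (T ∘L S) ≤ ENNReal.ofReal (‖S‖ ^ 2) * hsSq T := by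
  have h := hsSq_comp_le (S†) (T†)
  rwa [← ContinuousLinearMap.adjoint_comp, hsSq_adjoint, hsSq_adjoint,
    LinearIsometryEquiv.norm_map] at h

theorem IsHilbertSchmidt.adjoint {T : H →L[ℝ] H} (hT : IsHilbertSchmidt T) :
    IsHilbertSchmidt (T†) := (hsSq_adjoint T).trans_lt hT

theorem IsHilbertSchmidt.comp_left {T : H →L[ℝ] H} (hT : IsHilbertSchmidt T) (S : H →L[ℝ] H) :
    IsHilbertSchmidt (S ∘L T) :=
  (hsSq_comp_le S T).trans_lt (ENNReal.mul_lt_top ENNReal.ofReal_lt_top hT)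

theorem IsHilbertSchmidt.comp_right {T : H →L[ℝ] H} (hT : IsHilbertSchmidt T) (S : H →L[ℝ] H) :
    IsHilbertSchmidt (T ∘L S) :=
  (hsSq_comp_le' S T).trans_lt (ENNReal.mul_lt_top ENNReal.ofReal_lt_top hT)

theorem IsHilbertSchmidt.summable {T : H →L[ℝ] H} (hT : IsHilbertSchmidt T) {ι : Type*}
    (b : HilbertBasis ι ℝ H) : Summable fun i => ‖T (b i)‖ ^ 2 := by
  have h : ∑' i, ENNReal.ofReal (‖T (b i)‖ ^ 2) ≠ ∞ := by
    rw [tsum_norm_sq]; exact hT.ne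
  simpa [ENNReal.toReal_ofReal, sq_nonneg] using ENNReal.summable_toReal h

theorem norm_sq_le_hsSq (T : H →L[ℝ] H) (x : H) :
    ENNReal.ofReal (‖T x‖ ^ 2) ≤ hsSq T * ENNReal.ofReal (‖x‖ ^ 2) := by
  rw [← tsum_ofReal_inner_sq (basis H), ← hsSq_adjoint, hsSq, ← ENNReal.tsum_mul_right]
  refine ENNReal.tsum_le_tsum fun i => ?_
  rw [← ENNReal.ofReal_mul (by positivity), ← mul_pow, ← ContinuousLinearMap.adjoint_inner_left]
  refine ENNReal.ofReal_le_ofReal (sq_le_sq' ?_ ?_)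
  · exact neg_le_of_abs_le (abs_real_inner_le_norm _ _)
  · exact real_inner_le_norm _ _

theorem norm_sq_le_toReal_hsSq {T : H →L[ℝ] H} (hT : IsHilbertSchmidt T) :
    ‖T‖ ^ 2 ≤ (hsSq T).toReal := by
  have h : ‖T‖ ≤ √(hsSq T).toReal := by
    refine T.opNorm_le_bound (Real.sqrt_nonneg _) fun x => ?_
    refine abs_le_of_sq_le_sq' ?_ (by positivity) |>.2
    rw [mul_pow, Real.sq_sqrt ENNReal.toReal_nonneg]
    have h := norm_sq_le_hsSq T x
    rw [← ENNReal.ofReal_toReal (show hsSq T ≠ ∞ from hT.ne),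
      ← ENNReal.ofReal_mul ENNReal.toReal_nonneg] at h
    exact (ENNReal.ofReal_le_ofReal_iff (by positivity)).1 h
  calc ‖T‖ ^ 2 ≤ √(hsSq T).toReal ^ 2 := pow_le_pow_left₀ (norm_nonneg _) h 2
    _ = _ := Real.sq_sqrt ENNReal.toReal_nonneg

/-- Truncating to finitely many basis vectors gives finite rank operators, and the Hilbert–Schmidt
norm of the error is a tail of a convergent series that dominates the operator norm. -/
theorem IsHilbertSchmidt.isCompactOperator {T : H →L[ℝ] H} (hT : IsHilbertSchmidt T) :
    IsCompactOperator T := by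
  classical
  let b := basis H
  let F : Finset (basisIndex H) → H →L[ℝ] H := fun s =>
    ∑ i ∈ s, (ContinuousLinearMap.toSpanSingleton ℝ (T (b i))).comp (innerSL ℝ (b i))
  have hF : ∀ s i, F s (b i) = if i ∈ s then T (b i) else 0 := fun s i => by
    have : ∀ j, inner ℝ (b j) (b i) • T (b j) = if i = j then T (b i) else 0 := fun j => by
      split_ifs with h
      · subst h; rw [inner_basis_self, one_smul]
      · rw [inner_basis_of_ne b (Ne.symm h), zero_smul]
    simp [F, this]
  have hFs : ∀ s, hsSq (T - F s) = ∑' i : { i // i ∉ s }, ENNReal.ofReal (‖T (b i)‖ ^ 2) := by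
    intro s
    rw [hsSq]
    change ∑' i, _ = ∑' i : ((s : Set (basisIndex H))ᶜ : Set _), ENNReal.ofReal (‖T (b i)‖ ^ 2)
    rw [tsum_subtype ((s : Set (basisIndex H))ᶜ) fun i => ENNReal.ofReal (‖T (b i)‖ ^ 2)]
    refine tsum_congr fun i => ?_
    by_cases hi : i ∈ s <;> simp [hF, hi, b]
  have hlim : Tendsto (fun s => hsSq (T - F s)) atTop (𝓝 0) := by
    simp_rw [hFs]
    exact ENNReal.tendsto_tsum_compl_atTop_zero hT.ne
  have hHS : ∀ s, IsHilbertSchmidt (T - F s) := fun s => by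
    change hsSq _ < ∞
    rw [hFs]
    exact (ENNReal.tsum_comp_le_tsum_of_injective Subtype.val_injective _).trans_lt hT
  refine isCompactOperator_of_tendsto (l := (atTop : Filter (Finset (basisIndex H)))) (F := F)
    ?_ (Eventually.of_forall fun s => ?_)
  · rw [tendsto_iff_norm_sub_tendsto_zero]
    have h2 : Tendsto (fun s => √(hsSq (T - F s)).toReal) atTop (𝓝 0) := by
      have := (ENNReal.tendsto_toReal ENNReal.zero_ne_top).comp hlim
      simpa [Function.comp_def] using (Real.continuous_sqrt.tendsto 0).comp this
    refine squeeze_zero (fun s => norm_nonneg _) (fun s => ?_) h2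
    rw [norm_sub_rev]
    exact Real.le_sqrt_of_sq_le (norm_sq_le_toReal_hsSq (hHS s))
  · simp only [F]
    induction s using Finset.induction_on with
    | empty => simpa using isCompactOperator_zero
    | insert i s hi ih =>
      rw [Finset.sum_insert hi]
      refine IsCompactOperator.add ?_ ih
      exact IsCompactOperator.comp_clm (f := ContinuousLinearMap.toSpanSingleton ℝ (T (b i)))
        (isCompactOperator_of_locallyCompactSpace_rng _) _

theorem summable_mul_of_sq {ι : Type*} {f g : ι → ℝ} (hf : Summable fun i => f i ^ 2)
    (hg : Summable fun i => g i ^ 2) : Summable fun i => f i * g i := by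
  refine Summable.of_norm_bounded (hf.add hg) fun i => ?_
  rw [Real.norm_eq_abs, abs_le]
  constructor <;> nlinarith [sq_nonneg (f i + g i), sq_nonneg (f i - g i), sq_nonneg (f i),
    sq_nonneg (g i)]

/-- The matrices of S and T* are square summable, so the double series of their entrywise products
converges absolutely and can be summed by rows or by columns. Both the cyclicity of the trace and
its independence of the basis come from this. -/
theorem hasSum_inner_swap {ι κ : Type*} (b : HilbertBasis ι ℝ H) (c : HilbertBasis κ ℝ H)
    {S T : H →L[ℝ] H} (hS : IsHilbertSchmidt S) (hT : IsHilbertSchmidt T) :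
    HasSum (fun i => inner ℝ ((T†) (b i)) (S (b i))) (∑' k, inner ℝ ((S†) (c k)) (T (c k))) := by
  have aux : ∀ {R : H →L[ℝ] H}, IsHilbertSchmidt R →
      Summable fun p : ι × κ => inner ℝ (c p.2) (R (b p.1)) ^ 2 := fun {R} hR => by
    refine (summable_prod_of_nonneg (fun p => sq_nonneg _)).2
      ⟨fun i => (hasSum_inner_sq c (R (b i))).summable, ?_⟩
    refine (hR.summable b).congr fun i => ?_
    exact (hasSum_inner_sq c (R (b i))).tsum_eq.symm
  have hsum := summable_mul_of_sq (aux hT.adjoint) (aux hS)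
  have h1 : ∀ i, HasSum (fun k => inner ℝ (c k) ((T†) (b i)) * inner ℝ (c k) (S (b i)))
      (inner ℝ ((T†) (b i)) (S (b i))) := fun i => by
    simpa only [real_inner_comm ((T†) (b i))] using c.hasSum_inner_mul_inner ((T†) (b i)) (S (b i))
  have h2 : ∀ k, HasSum (fun i => inner ℝ (c k) ((T†) (b i)) * inner ℝ (c k) (S (b i)))
      (inner ℝ ((S†) (c k)) (T (c k))) := fun k => by
    have e : (fun i => inner ℝ (c k) ((T†) (b i)) * inner ℝ (c k) (S (b i))) =
        fun i => inner ℝ ((S†) (c k)) (b i) * inner ℝ (b i) (T (c k)) := funext fun i => by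
      rw [ContinuousLinearMap.adjoint_inner_right, ContinuousLinearMap.adjoint_inner_left, mul_comm,
        real_inner_comm (b i)]
    rw [e]
    exact b.hasSum_inner_mul_inner ((S†) (c k)) (T (c k))
  have h3 := hsum.hasSum.prod_fiberwise h1
  have h4 := ((Equiv.prodComm κ ι).hasSum_iff.2 hsum.hasSum).prod_fiberwise h2
  rw [h4.tsum_eq]
  exact h3

theorem hasSum_trace_comp {ι : Type*} (b : HilbertBasis ι ℝ H)
    {S T : H →L[ℝ] H} (hS : IsHilbertSchmidt S) (hT : IsHilbertSchmidt T) :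
    HasSum (fun i => inner ℝ (b i) (T (S (b i)))) (trace (S ∘L T)) := by
  have h := hasSum_inner_swap b (basis H) hS hT
  simp only [ContinuousLinearMap.adjoint_inner_left] at h
  exact h

theorem trace_comp_comm {S T : H →L[ℝ] H} (hS : IsHilbertSchmidt S) (hT : IsHilbertSchmidt T) :
    trace (S ∘L T) = trace (T ∘L S) :=
  (hasSum_trace_comp (basis H) hS hT).unique
    (by rw [trace]; exact (hasSum_trace_comp (basis H) hS hT).summable.hasSum)

end HilbertSchmidt

/-! ### Square roots and the trace norm -/

section SquareRoots

universe u

variable {H : Type u} [NormedAddCommGroup H] [InnerProductSpace ℝ H] [CompleteSpace H]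

theorem IsPositive.adjoint_eq' {S : H →L[ℝ] H} (hS : S.IsPositive) : S† = S :=
  hS.isSelfAdjoint.adjoint_eq

theorem IsPositive.inner_comm {S : H →L[ℝ] H} (hS : S.IsPositive) (x y : H) :
    inner ℝ (S x) y = inner ℝ x (S y) := hS.inner_left_eq_inner_right x y

theorem norm_sq_of_sq {S T : H →L[ℝ] H} (hS : S.IsPositive) (h : S ∘L S = T) (x : H) :
    ‖S x‖ ^ 2 = inner ℝ x (T x) := by
  rw [← h, ← real_inner_self_eq_norm_sq, IsPositive.inner_comm hS]; rfl

/-- For d > 0 the vector z = S x - √d x satisfies S z = -√d z, which positivity of S allows only for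
z = 0. Thus every positive root acts alike on an eigenbasis, whence uniqueness of the root for
compact operators. -/
theorem sqrt_eigenvector {S T : H →L[ℝ] H} (hS : S.IsPositive) (h : S ∘L S = T)
    {x : H} {d : ℝ} (hx : T x = d • x) : S x = √d • x := by
  have hSS : S (S x) = d • x := by rw [← hx, ← h]; rfl
  by_cases hx0 : x = 0
  · simp [hx0]
  have hd : 0 ≤ d := by
    have h1 := norm_sq_of_sq hS h x
    rw [hx, inner_smul_right, real_inner_self_eq_norm_sq] at h1
    exact nonneg_of_mul_nonneg_left (h1 ▸ sq_nonneg _) (by positivity)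
  rcases hd.eq_or_lt with rfl | hd
  · have h1 := norm_sq_of_sq hS h x
    rw [hx, zero_smul, inner_zero_right] at h1
    simpa using h1
  · have hz : S (S x - √d • x) = -(√d • (S x - √d • x)) := by
      rw [map_sub, map_smul, hSS, smul_sub, smul_smul, Real.mul_self_sqrt hd.le]
      abel
    have h1 := hS.inner_nonneg_left (S x - √d • x)
    rw [hz, inner_neg_left, real_inner_smul_left, real_inner_self_eq_norm_sq] at h1
    have h2 : 0 < √d := Real.sqrt_pos.2 hd
    have h3 : ‖S x - √d • x‖ ^ 2 ≤ 0 := by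
      by_contra! h4
      nlinarith [mul_pos h2 h4]
    have h4 : ‖S x - √d • x‖ = 0 := by
      have := sq_nonneg ‖S x - √d • x‖
      exact pow_eq_zero_iff (two_ne_zero) |>.1 (le_antisymm h3 this)
    exact sub_eq_zero.1 (norm_eq_zero.1 h4)

theorem sqrt_unique {S S' T : H →L[ℝ] H} (hT : IsCompactOperator T) (hTp : T.IsPositive)
    (hS : S.IsPositive) (h : S ∘L S = T) (hS' : S'.IsPositive) (h' : S' ∘L S' = T) : S = S' := by
  obtain ⟨ι, b, d, hb⟩ := exists_eigenbasis hT hTp.isSymmetric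
  exact clm_ext_basis b fun i => by rw [sqrt_eigenvector hS h (hb i), sqrt_eigenvector hS' h' (hb i)]

theorem IsPositive.eigenvalue_nonneg {T : H →L[ℝ] H} (hT : T.IsPositive) {ι : Type*}
    {b : HilbertBasis ι ℝ H} {d : ι → ℝ} (hb : ∀ i, T (b i) = d i • b i) (i : ι) : 0 ≤ d i := by
  have := hT.inner_nonneg_left (b i)
  rwa [hb, real_inner_smul_left, inner_basis_self, mul_one] at this

theorem isPositive_of_diagonal {T : H →L[ℝ] H} {ι : Type*} (b : HilbertBasis ι ℝ H) {d : ι → ℝ}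
    (hT : ∀ i x, inner ℝ (b i) (T x) = d i * inner ℝ (b i) x) (hd : ∀ i, 0 ≤ d i) :
    T.IsPositive := by
  have key : ∀ x y, HasSum (fun i => d i * (inner ℝ (b i) x * inner ℝ (b i) y)) (inner ℝ x (T y)) := by
    intro x y
    have h := b.hasSum_inner_mul_inner x (T y)
    simp only [hT, real_inner_comm (b _) x] at h
    rw [show (fun i => d i * (inner ℝ (b i) x * inner ℝ (b i) y)) =
      fun i => inner ℝ (b i) x * (d i * inner ℝ (b i) y) from funext fun i => by ring]
    simpa only [real_inner_comm x] using h
  rw [ContinuousLinearMap.isPositive_iff]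
  refine ⟨fun x y => ?_, fun x => ?_⟩
  · rw [real_inner_comm]
    refine (key y x).unique ?_
    have h := key x y
    simp only [mul_comm (inner ℝ _ x)] at h
    exact h
  · rw [real_inner_comm]
    exact (key x x).nonneg fun i => mul_nonneg (hd i) (mul_self_nonneg _)

theorem exists_sqrt {T : H →L[ℝ] H} (hT : IsCompactOperator T) (hTp : T.IsPositive) :
    ∃ S : H →L[ℝ] H, S.IsPositive ∧ S ∘L S = T := by
  obtain ⟨ι, b, d, hb⟩ := exists_eigenbasis hT hTp.isSymmetric
  have hd := IsPositive.eigenvalue_nonneg hTp hb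
  have hle : ∀ i, |√(d i)| ≤ √‖T‖ := fun i => by
    rw [abs_of_nonneg (Real.sqrt_nonneg _)]
    refine Real.sqrt_le_sqrt ?_
    have := T.le_opNorm (b i)
    rwa [hb, norm_smul, b.orthonormal.1 i, mul_one, mul_one, Real.norm_of_nonneg (hd i)] at this
  obtain ⟨S, hS, hSb⟩ := exists_diagonal b (fun i => √(d i)) _ hle
  refine ⟨S, isPositive_of_diagonal b hS fun i => Real.sqrt_nonneg _, clm_ext_basis b fun i => ?_⟩
  rw [ContinuousLinearMap.comp_apply, hSb, map_smul, hSb, smul_smul, Real.mul_self_sqrt (hd i), hb]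

theorem opSqrt_spec {T : H →L[ℝ] H} (h : ∃ S : H →L[ℝ] H, S.IsPositive ∧ S ∘L S = T) :
    (opSqrt T).IsPositive ∧ opSqrt T ∘L opSqrt T = T := by
  rw [opSqrt, dif_pos h]
  exact h.choose_spec

theorem opSqrt_isPositive {T : H →L[ℝ] H} (hT : IsCompactOperator T) (hTp : T.IsPositive) :
    (opSqrt T).IsPositive := (opSqrt_spec (exists_sqrt hT hTp)).1

theorem opSqrt_comp_self {T : H →L[ℝ] H} (hT : IsCompactOperator T) (hTp : T.IsPositive) :
    opSqrt T ∘L opSqrt T = T := (opSqrt_spec (exists_sqrt hT hTp)).2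

theorem opSqrt_eq {S T : H →L[ℝ] H} (hT : IsCompactOperator T) (hTp : T.IsPositive)
    (hS : S.IsPositive) (h : S ∘L S = T) : opSqrt T = S :=
  sqrt_unique hT hTp (opSqrt_isPositive hT hTp) (opSqrt_comp_self hT hTp) hS h

/-- Positivity is tested at x - t S x with t = 1/(‖S‖ + 1); the added 1 keeps t defined when S = 0.
The bound turns finite trace into finite Hilbert–Schmidt norm. -/
theorem IsPositive.norm_sq_le {S : H →L[ℝ] H} (hS : S.IsPositive) (x : H) :
    ‖S x‖ ^ 2 ≤ (‖S‖ + 1) * inner ℝ x (S x) := by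
  set t : ℝ := (‖S‖ + 1)⁻¹ with ht
  have hpos : 0 < ‖S‖ + 1 := by positivity
  have h0 := hS.inner_nonneg_right (x - t • S x)
  have h1 : inner ℝ (S x) (S (S x)) ≤ ‖S‖ * ‖S x‖ ^ 2 := by
    refine (real_inner_le_norm _ _).trans ?_
    nlinarith [S.le_opNorm (S x), norm_nonneg (S x)]
  have h2 : inner ℝ x (S (S x)) = ‖S x‖ ^ 2 := by
    rw [← IsPositive.inner_comm hS, real_inner_self_eq_norm_sq]
  simp only [map_sub, map_smul, inner_sub_left, inner_sub_right, real_inner_smul_left,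
    inner_smul_right, h2, real_inner_self_eq_norm_sq] at h0
  have ht1 : t * (‖S‖ + 1) = 1 := inv_mul_cancel₀ hpos.ne'
  have htpos : 0 < t := inv_pos.2 hpos
  have h3 : t * ‖S x‖ ^ 2 ≤ inner ℝ x (S x) := by
    nlinarith [mul_le_mul_of_nonneg_left h1 (sq_nonneg t), mul_pos htpos htpos, sq_nonneg ‖S x‖,
      mul_nonneg (mul_nonneg htpos.le htpos.le) (sq_nonneg ‖S x‖)]
  calc ‖S x‖ ^ 2 = (‖S‖ + 1) * (t * ‖S x‖ ^ 2) := by rw [← mul_assoc, mul_comm _ t, ht1, one_mul]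
    _ ≤ _ := by gcongr

theorem isHilbertSchmidt_of_isPositive {S : H →L[ℝ] H} (hS : S.IsPositive)
    (h : ∑' i, ENNReal.ofReal (inner ℝ (basis H i) (S (basis H i))) < ∞) : IsHilbertSchmidt S := by
  have hle : hsSq S ≤ ENNReal.ofReal (‖S‖ + 1) *
      ∑' i, ENNReal.ofReal (inner ℝ (basis H i) (S (basis H i))) := by
    rw [hsSq, ← ENNReal.tsum_mul_left]
    refine ENNReal.tsum_le_tsum fun i => ?_
    rw [← ENNReal.ofReal_mul (by positivity)]
    exact ENNReal.ofReal_le_ofReal (IsPositive.norm_sq_le hS _)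
  exact hle.trans_lt (ENNReal.mul_lt_top ENNReal.ofReal_lt_top h)

/-- A covariance operator is compact, and its square root is Hilbert–Schmidt. -/
theorem IsCovariance.isCompactOperator {A : H →L[ℝ] H} (hA : IsCovariance A) :
    IsCompactOperator A ∧ traceNorm A =
      ∑' i, ENNReal.ofReal (inner ℝ (basis H i) (A (basis H i))) := by
  obtain ⟨hp, ht⟩ := hA
  -- A is itself a positive root of A*A = A², so `opSqrt` does not take its default value even
  -- before compactness is known. The finite trace then makes this root Hilbert–Schmidt, so A*A is
  -- compact and uniqueness identifies the root with A.
  have hspec := opSqrt_spec (T := A† ∘L A) ⟨A, hp, by rw [IsPositive.adjoint_eq' hp]⟩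
  have hHS := isHilbertSchmidt_of_isPositive hspec.1 ht
  have hc : IsCompactOperator (A† ∘L A) := by
    rw [← hspec.2]; exact (hHS.comp_left _).isCompactOperator
  have heq : opSqrt (A† ∘L A) = A := by
    refine sqrt_unique hc ?_ hspec.1 hspec.2 hp (by rw [IsPositive.adjoint_eq' hp])
    exact ContinuousLinearMap.isPositive_adjoint_comp_self A
  refine ⟨?_, by rw [traceNorm, heq]⟩
  rw [← heq]
  exact hHS.isCompactOperator

theorem IsCovariance.sqrt_isPositive {A : H →L[ℝ] H} (hA : IsCovariance A) :
    (opSqrt A).IsPositive := opSqrt_isPositive hA.isCompactOperator.1 hA.1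

theorem IsCovariance.sqrt_comp_self {A : H →L[ℝ] H} (hA : IsCovariance A) :
    opSqrt A ∘L opSqrt A = A := opSqrt_comp_self hA.isCompactOperator.1 hA.1

theorem IsCovariance.sqrt_isHilbertSchmidt {A : H →L[ℝ] H} (hA : IsCovariance A) :
    IsHilbertSchmidt (opSqrt A) := by
  have h := hA.isCompactOperator.2
  have h2 := hA.2
  rw [IsTraceClass, h] at h2
  refine lt_of_eq_of_lt (tsum_congr fun i => ?_) h2
  rw [norm_sq_of_sq hA.sqrt_isPositive hA.sqrt_comp_self]

theorem tsum_mul_le_sqrt_mul_sqrt {ι : Type*} (f g : ι → ℝ≥0∞) :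
    ∑' i, f i * g i ≤ (∑' i, f i ^ 2) ^ (1 / 2 : ℝ) * (∑' i, g i ^ 2) ^ (1 / 2 : ℝ) := by
  rw [ENNReal.tsum_eq_iSup_sum]
  refine iSup_le fun s => (ENNReal.inner_le_Lp_mul_Lq s f g Real.HolderConjugate.two_two).trans ?_
  simp only [ENNReal.rpow_ofNat]
  gcongr <;> exact ENNReal.sum_le_tsum s

/-- Hölder's inequality for the trace norm of a product. -/
theorem traceNorm_comp_le {X Y : H →L[ℝ] H} (hY : IsHilbertSchmidt Y) :
    traceNorm (X ∘L Y) ≤ hsSq X ^ (1 / 2 : ℝ) * hsSq Y ^ (1 / 2 : ℝ) := by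
  set T := X ∘L Y with hT
  have hc : IsCompactOperator (T† ∘L T) := ((hY.comp_left X).comp_left _).isCompactOperator
  have hp := ContinuousLinearMap.isPositive_adjoint_comp_self T
  have hSp := opSqrt_isPositive hc hp
  have hSS := opSqrt_comp_self hc hp
  have hn : ∀ x, ‖opSqrt (T† ∘L T) x‖ = ‖T x‖ := fun x => by
    refine (pow_left_inj₀ (norm_nonneg _) (norm_nonneg _) two_ne_zero).1 ?_
    rw [norm_sq_of_sq hSp hSS, ContinuousLinearMap.comp_apply,
      ContinuousLinearMap.adjoint_inner_right, real_inner_self_eq_norm_sq]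
  -- W carries T x to |T| x, so ⟨e, |T| e⟩ = ⟨(W X)* e, Y e⟩ and the Cauchy–Schwarz inequality
  -- separates X from Y.
  obtain ⟨W, hW, -, hWn, -⟩ := exists_partialIsometry (opSqrt (T† ∘L T)) T hn
  have hWX : hsSq ((W ∘L X)†) ≤ hsSq X := by
    rw [hsSq_adjoint]
    refine ENNReal.tsum_le_tsum fun i => ENNReal.ofReal_le_ofReal ?_
    exact pow_le_pow_left₀ (norm_nonneg _) (hWn _) 2
  calc traceNorm T
      ≤ ∑' i, ENNReal.ofReal ‖((W ∘L X)†) (basis H i)‖ * ENNReal.ofReal ‖Y (basis H i)‖ := by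
        refine ENNReal.tsum_le_tsum fun i => ?_
        rw [← ENNReal.ofReal_mul (norm_nonneg _)]
        refine ENNReal.ofReal_le_ofReal ?_
        rw [← hW]
        have : W (T (basis H i)) = (W ∘L X) (Y (basis H i)) := rfl
        rw [this, ← ContinuousLinearMap.adjoint_inner_left]
        exact real_inner_le_norm _ _
    _ ≤ _ := tsum_mul_le_sqrt_mul_sqrt _ _
    _ = hsSq ((W ∘L X)†) ^ (1 / 2 : ℝ) * hsSq Y ^ (1 / 2 : ℝ) := by
        simp only [← ENNReal.ofReal_pow (norm_nonneg _)]; rfl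
    _ ≤ _ := by gcongr

theorem isTraceClass_comp {X Y : H →L[ℝ] H} (hX : IsHilbertSchmidt X) (hY : IsHilbertSchmidt Y) :
    IsTraceClass (X ∘L Y) :=
  (traceNorm_comp_le hY).trans_lt <| ENNReal.mul_lt_top
    (ENNReal.rpow_lt_top_of_nonneg (by norm_num) (ne_of_lt hX))
    (ENNReal.rpow_lt_top_of_nonneg (by norm_num) (ne_of_lt hY))

end SquareRoots

/-! ### The canonical Green's operator and its polar form -/

section Canonical

universe u

variable {H : Type u} [NormedAddCommGroup H] [InnerProductSpace ℝ H] [CompleteSpace H]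

/-- T is injective on the complement of its kernel, so the two conditions determine the
pseudoinverse pointwise. Any bounded candidate satisfying them rules out the default values of
`pinv` and `pinvComp`. -/
theorem pinvComp_eq {T S X : H →L[ℝ] H} (h1 : ∀ x, X x ∈ T.kerᗮ) (h2 : ∀ x, T (X x) = S x) :
    pinvComp T S = X := by
  have hX : ∀ x, X x = pinv T (S x) := fun x => by
    have hp : T.range.topologicalClosure.starProjection (S x) = S x := by
      rw [Submodule.starProjection_eq_self_iff, ← h2]
      exact Submodule.le_topologicalClosure _ (LinearMap.mem_range_self _ _)
    have hex : ∃ z ∈ T.kerᗮ, T z = T.range.topologicalClosure.starProjection (S x) :=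
      ⟨X x, h1 x, by rw [hp, h2]⟩
    rw [pinv, dif_pos hex]
    obtain ⟨h3, h4⟩ := hex.choose_spec
    have h5 : X x - hex.choose ∈ T.ker := by
      rw [LinearMap.mem_ker]
      change T (X x - hex.choose) = 0
      rw [map_sub, h4, hp, h2, sub_self]
    exact sub_eq_zero.1 (inner_self_eq_zero (𝕜 := ℝ).1
      (T.kerᗮ.sub_mem (h1 x) h3 _ h5))
  have hex : ∃ X : H →L[ℝ] H, ∀ x, X x = pinv T (S x) := ⟨X, hX⟩
  rw [pinvComp, dif_pos hex]
  ext x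
  rw [hex.choose_spec, hX]

/-- From X* = Y* W*, the vector W* z lies in the kernel of Y*, where W vanishes; then ‖W* z‖² = ⟨z,
W W* z⟩ = 0. -/
theorem adjoint_vanish_of_partialIsometry {X Y W : H →L[ℝ] H} (hW : ∀ x, W (Y x) = X x)
    (h0 : ∀ z, (Y†) z = 0 → W z = 0) {z : H} (hz : (X†) z = 0) : (W†) z = 0 := by
  have h1 : X = W ∘L Y := by ext x; exact (hW x).symm
  rw [h1, ContinuousLinearMap.adjoint_comp] at hz
  have h2 : W ((W†) z) = 0 := h0 _ hz
  have h3 : inner ℝ ((W†) z) ((W†) z) = 0 := by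
    rw [ContinuousLinearMap.adjoint_inner_left, h2, inner_zero_right]
  exact inner_self_eq_zero.1 h3

/-- Both squares equal ⟨x, A x⟩. Consequently G* is A^{1/2} followed by a partial isometry. -/
theorem IsGreen.norm_adjoint {A G : H →L[ℝ] H} (hA : IsCovariance A) (h : G ∘L G† = A) (x : H) :
    ‖(G†) x‖ = ‖opSqrt A x‖ := by
  refine (pow_left_inj₀ (norm_nonneg _) (norm_nonneg _) two_ne_zero).1 ?_
  rw [norm_sq_of_sq hA.sqrt_isPositive hA.sqrt_comp_self, ← h, ← real_inner_self_eq_norm_sq,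
    ContinuousLinearMap.adjoint_inner_left]
  rfl

theorem isGreen_of_comp_adjoint {A G : H →L[ℝ] H} (hA : IsCovariance A) (h : G ∘L G† = A) :
    IsGreen A G := by
  refine ⟨?_, h⟩
  have : IsHilbertSchmidt (G†) := by
    refine lt_of_eq_of_lt (tsum_congr fun i => ?_) hA.sqrt_isHilbertSchmidt
    rw [IsGreen.norm_adjoint hA h]
  simpa using this.adjoint

theorem isGreen_opSqrt {A : H →L[ℝ] H} (hA : IsCovariance A) : IsGreen A (opSqrt A) :=
  isGreen_of_comp_adjoint hA (by
    rw [IsPositive.adjoint_eq' hA.sqrt_isPositive, hA.sqrt_comp_self])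

theorem opP_isPositive {A B : H →L[ℝ] H} (hA : IsCovariance A) (hB : IsCovariance B) :
    (opP A B).IsPositive := by
  have h := hB.1.conj_adjoint (opSqrt A)
  rwa [IsPositive.adjoint_eq' hA.sqrt_isPositive] at h

theorem opP_isCompactOperator {A B : H →L[ℝ] H} (hA : IsCovariance A) :
    IsCompactOperator (opP A B) :=
  ((hA.sqrt_isHilbertSchmidt.comp_left B).comp_left (opSqrt A)).isCompactOperator

theorem norm_sqrt_opP {A B : H →L[ℝ] H} (hA : IsCovariance A) (hB : IsCovariance B) (x : H) :
    ‖opSqrt (opP A B) x‖ = ‖opSqrt B (opSqrt A x)‖ := by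
  refine (pow_left_inj₀ (norm_nonneg _) (norm_nonneg _) two_ne_zero).1 ?_
  have hc := opP_isCompactOperator (B := B) hA
  have hp := opP_isPositive hA hB
  rw [norm_sq_of_sq (opSqrt_isPositive hc hp) (opSqrt_comp_self hc hp),
    norm_sq_of_sq hB.sqrt_isPositive hB.sqrt_comp_self, IsPositive.inner_comm hA.sqrt_isPositive]
  rfl

/-- `V` is the partial isometry in the polar decomposition `V B^{1/2} A^{1/2} = P^{1/2}`. -/
structure IsPolar (A B V : H →L[ℝ] H) : Prop where
  apply : ∀ x, V (opSqrt B (opSqrt A x)) = opSqrt (opP A B) x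
  adjoint_apply : ∀ x, (V†) (opSqrt (opP A B) x) = opSqrt B (opSqrt A x)
  norm_le : ∀ z, ‖V z‖ ≤ ‖z‖
  vanish : ∀ z, opSqrt A (opSqrt B z) = 0 → V z = 0

theorem exists_isPolar {A B : H →L[ℝ] H} (hA : IsCovariance A) (hB : IsCovariance B) :
    ∃ V, IsPolar A B V := by
  obtain ⟨V, h1, h2, h3, h4⟩ := exists_partialIsometry (opSqrt (opP A B)) (opSqrt B ∘L opSqrt A)
    (norm_sqrt_opP hA hB)
  refine ⟨V, h1, h2, h3, fun z hz => h4 z ?_⟩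
  rw [ContinuousLinearMap.adjoint_comp, IsPositive.adjoint_eq' hA.sqrt_isPositive,
    IsPositive.adjoint_eq' hB.sqrt_isPositive]
  exact hz

variable {A B V : H →L[ℝ] H}

theorem sqrt_opP_isPositive (hA : IsCovariance A) (hB : IsCovariance B) :
    (opSqrt (opP A B)).IsPositive :=
  opSqrt_isPositive (opP_isCompactOperator hA) (opP_isPositive hA hB)

theorem IsPolar.adjoint_vanish (hV : IsPolar A B V) (hA : IsCovariance A) (hB : IsCovariance B)
    {z : H} (hz : opSqrt (opP A B) z = 0) : (V†) z = 0 := by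
  refine adjoint_vanish_of_partialIsometry (Y := opSqrt B ∘L opSqrt A) hV.apply (fun z hz => ?_)
    (by rwa [IsPositive.adjoint_eq' (sqrt_opP_isPositive hA hB)])
  rw [ContinuousLinearMap.adjoint_comp, IsPositive.adjoint_eq' hA.sqrt_isPositive,
    IsPositive.adjoint_eq' hB.sqrt_isPositive] at hz
  exact hV.vanish z hz

/-- `A^{1/2} B^{1/2} V* = P^{1/2}`. -/
theorem IsPolar.sqrt_sqrt_adjoint (hV : IsPolar A B V) (hA : IsCovariance A)
    (hB : IsCovariance B) (x : H) : opSqrt A (opSqrt B ((V†) x)) = opSqrt (opP A B) x := by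
  refine ext_inner_right ℝ fun y => ?_
  rw [IsPositive.inner_comm hA.sqrt_isPositive, IsPositive.inner_comm hB.sqrt_isPositive,
    ContinuousLinearMap.adjoint_inner_left, hV.apply,
    IsPositive.inner_comm (sqrt_opP_isPositive hA hB)]

/-- `P^{1/2} V = A^{1/2} B^{1/2}`. -/
theorem IsPolar.sqrt_opP_apply (hV : IsPolar A B V) (hA : IsCovariance A)
    (hB : IsCovariance B) (x : H) : opSqrt (opP A B) (V x) = opSqrt A (opSqrt B x) := by
  refine ext_inner_right ℝ fun y => ?_
  rw [IsPositive.inner_comm hA.sqrt_isPositive, IsPositive.inner_comm hB.sqrt_isPositive,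
    ← hV.adjoint_apply, ContinuousLinearMap.adjoint_inner_right,
    IsPositive.inner_comm (sqrt_opP_isPositive hA hB)]

/-- V*V is the projection onto the complement of N = ker(A^{1/2}B^{1/2}). Indeed y - Πy - V*Vy lies
in N because A^{1/2}B^{1/2}V*V = P^{1/2}V = A^{1/2}B^{1/2}, and it is orthogonal to N because V
vanishes there. -/
theorem IsPolar.adjoint_comp_self (hV : IsPolar A B V) (hA : IsCovariance A)
    (hB : IsCovariance B) (y : H) :
    (V†) (V y) + (opSqrt A ∘L opSqrt B).ker.starProjection y = y := by
  set N := (opSqrt A ∘L opSqrt B).ker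
  have hN : ∀ w ∈ N, opSqrt A (opSqrt B w) = 0 := fun w hw => hw
  have h1 : y - N.starProjection y - (V†) (V y) ∈ N := by
    rw [LinearMap.mem_ker]
    change opSqrt A (opSqrt B (y - N.starProjection y - (V†) (V y))) = 0
    rw [map_sub, map_sub, map_sub, map_sub, hN _ (Submodule.starProjection_apply_mem N y),
      hV.sqrt_sqrt_adjoint hA hB, hV.sqrt_opP_apply hA hB, sub_zero, sub_self]
  have h2 : inner ℝ (y - N.starProjection y - (V†) (V y)) (y - N.starProjection y - (V†) (V y))
      = 0 := by
    conv_lhs => rw [inner_sub_right]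
    rw [ContinuousLinearMap.adjoint_inner_right, hV.vanish _ (hN _ h1), inner_zero_left, sub_zero]
    exact (Submodule.sub_starProjection_mem_orthogonal (K := N) y) _ h1
  have h3 := inner_self_eq_zero.1 h2
  rw [sub_sub, sub_eq_zero] at h3
  rw [add_comm, ← h3]

theorem ker_opSqrt (hA : IsCovariance A) : (opSqrt A).ker = A.ker := by
  ext x
  simp only [LinearMap.mem_ker, ContinuousLinearMap.coe_coe]
  constructor
  · intro h
    rw [← hA.sqrt_comp_self, ContinuousLinearMap.comp_apply, h, map_zero]
  · intro h
    have := norm_sq_of_sq hA.sqrt_isPositive hA.sqrt_comp_self x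
    rw [h, inner_zero_right] at this
    simpa using this

theorem schur_isPositive (hB : IsCovariance B) : (schur A B).IsPositive := by
  have h := (ContinuousLinearMap.IsPositive.of_isStarProjection
    (isStarProjection_starProjection (U := (opSqrt A ∘L opSqrt B).ker))).conj_adjoint (opSqrt B)
  rwa [IsPositive.adjoint_eq' hB.sqrt_isPositive] at h

theorem schur_isCompactOperator (hB : IsCovariance B) : IsCompactOperator (schur A B) :=
  ((hB.sqrt_isHilbertSchmidt.comp_left _).comp_left _).isCompactOperator

theorem sqrt_schur_isPositive (hB : IsCovariance B) : (opSqrt (schur A B)).IsPositive :=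
  opSqrt_isPositive (schur_isCompactOperator hB) (schur_isPositive hB)

theorem sqrt_schur_comp_self (hB : IsCovariance B) :
    opSqrt (schur A B) ∘L opSqrt (schur A B) = schur A B :=
  opSqrt_comp_self (schur_isCompactOperator hB) (schur_isPositive hB)

/-- The range of B^{1/2}A^{1/2} is orthogonal to ker(A^{1/2}B^{1/2}), so the projection in the Schur
operator kills it. This is why B/A lives on the kernel of A. -/
theorem sqrt_schur_sqrt (hA : IsCovariance A) (hB : IsCovariance B) (x : H) :
    opSqrt (schur A B) (opSqrt A x) = 0 := by
  have h : (opSqrt A ∘L opSqrt B).ker.starProjection (opSqrt B (opSqrt A x)) = 0 := by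
    rw [Submodule.starProjection_apply_eq_zero_iff]
    intro z hz
    rw [← IsPositive.inner_comm hB.sqrt_isPositive, ← IsPositive.inner_comm hA.sqrt_isPositive,
      show opSqrt A (opSqrt B z) = 0 from hz, inner_zero_left]
  have h1 := norm_sq_of_sq (sqrt_schur_isPositive (A := A) hB) (sqrt_schur_comp_self hB) (opSqrt A x)
  rw [schur, ContinuousLinearMap.comp_apply, ContinuousLinearMap.comp_apply, h, map_zero,
    inner_zero_right] at h1
  simpa [schur] using h1

theorem sqrt_sqrt_schur (hA : IsCovariance A) (hB : IsCovariance B) (x : H) :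
    opSqrt A (opSqrt (schur A B) x) = 0 := by
  refine ext_inner_right ℝ fun y => ?_
  rw [IsPositive.inner_comm hA.sqrt_isPositive, IsPositive.inner_comm (sqrt_schur_isPositive hB),
    sqrt_schur_sqrt hA hB, inner_zero_right, inner_zero_left]

/-- Let p and q project onto H₁ and H₂. The identity A^{1/2}B^{1/2}V* = P^{1/2} makes the first
block p B^{1/2}V*. The identity P^{1/2}V = A^{1/2}B^{1/2} makes the other pseudoinverse V B^{1/2} q,
with adjoint q B^{1/2}V*. Then p + q = I merges the two. -/
theorem IsPolar.canonicalM_eq (hV : IsPolar A B V) (hA : IsCovariance A) (hB : IsCovariance B) :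
    canonicalM A B = opSqrt B ∘L V† + opSqrt (schur A B) := by
  have h1 : pinvComp (opSqrt A) (opSqrt (opP A B)) =
      A.kerᗮ.starProjection ∘L opSqrt B ∘L V† := by
    refine pinvComp_eq (fun x => ?_) fun x => ?_
    · rw [ker_opSqrt hA]
      exact Submodule.starProjection_apply_mem _ _
    · rw [← hV.sqrt_sqrt_adjoint hA hB, ← sub_eq_zero, ← map_sub]
      have : A.kerᗮ.starProjection (opSqrt B ((V†) x)) - opSqrt B ((V†) x) ∈ (opSqrt A).ker := by
        rw [ker_opSqrt hA, ← neg_sub]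
        refine A.ker.neg_mem ?_
        have := Submodule.sub_starProjection_mem_orthogonal (K := A.kerᗮ) (opSqrt B ((V†) x))
        rwa [Submodule.orthogonal_orthogonal] at this
      exact this
  have h2 : pinvComp (opSqrt (opP A B)) (opSqrt A ∘L B ∘L A.ker.starProjection) =
      V ∘L opSqrt B ∘L A.ker.starProjection := by
    refine pinvComp_eq (fun x z hz => ?_) fun x => ?_
    · change inner ℝ z (V _) = 0
      rw [← ContinuousLinearMap.adjoint_inner_left, hV.adjoint_vanish hA hB hz, inner_zero_left]
    · change opSqrt (opP A B) (V _) = _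
      rw [hV.sqrt_opP_apply hA hB]
      conv_rhs => rw [← hB.sqrt_comp_self]
      rfl
  rw [canonicalM, h1, h2, ContinuousLinearMap.adjoint_comp, ContinuousLinearMap.adjoint_comp,
    IsPositive.adjoint_eq' hB.sqrt_isPositive, (isSelfAdjoint_starProjection _).adjoint_eq]
  congr 1
  ext x
  simp only [add_apply, ContinuousLinearMap.comp_apply]
  rw [add_comm]
  exact Submodule.starProjection_add_starProjection_orthogonal _

theorem IsPolar.adjoint_sqrt_schur (hV : IsPolar A B V) (hA : IsCovariance A)
    (hB : IsCovariance B) (x : H) : (V†) (opSqrt (schur A B) x) = 0 := by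
  refine hV.adjoint_vanish hA hB ?_
  rw [← norm_eq_zero, norm_sqrt_opP hA hB, sqrt_sqrt_schur hA hB, map_zero, norm_zero]

theorem IsPolar.canonicalM_adjoint (hV : IsPolar A B V) (hA : IsCovariance A)
    (hB : IsCovariance B) : (canonicalM A B)† = V ∘L opSqrt B + opSqrt (schur A B) := by
  rw [hV.canonicalM_eq hA hB, map_add, ContinuousLinearMap.adjoint_comp,
    ContinuousLinearMap.adjoint_adjoint, IsPositive.adjoint_eq' hB.sqrt_isPositive,
    IsPositive.adjoint_eq' (sqrt_schur_isPositive hB)]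

theorem IsPolar.canonicalC_eq (hV : IsPolar A B V) (hA : IsCovariance A) (hB : IsCovariance B) :
    canonicalC A B = opSqrt A ∘L V ∘L opSqrt B := by
  ext x
  rw [canonicalC, hV.canonicalM_adjoint hA hB]
  simp [sqrt_sqrt_schur hA hB]

/-- The cross terms vanish because V* kills the range of (B/A)^{1/2}. What remains is B^{1/2}(V*V +
Π)B^{1/2}, and V*V + Π = I. -/
theorem isGreen_canonicalM (hA : IsCovariance A) (hB : IsCovariance B) :
    IsGreen B (canonicalM A B) := by
  obtain ⟨V, hV⟩ := exists_isPolar hA hB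
  refine isGreen_of_comp_adjoint hB ?_
  rw [hV.canonicalM_adjoint hA hB, hV.canonicalM_eq hA hB]
  have hsV : ∀ x, opSqrt (schur A B) (V x) = 0 := fun x => by
    refine ext_inner_right ℝ fun y => ?_
    rw [IsPositive.inner_comm (sqrt_schur_isPositive hB), ← ContinuousLinearMap.adjoint_inner_right,
      hV.adjoint_sqrt_schur hA hB, inner_zero_right, inner_zero_left]
  have hss : ∀ x, opSqrt (schur A B) (opSqrt (schur A B) x) = schur A B x := fun x => by
    conv_rhs => rw [← sqrt_schur_comp_self hB]
    rfl
  ext x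
  simp only [add_apply, ContinuousLinearMap.comp_apply, map_add, hsV, hss,
    hV.adjoint_sqrt_schur hA hB, add_zero, zero_add, map_zero]
  rw [schur, ContinuousLinearMap.comp_apply, ContinuousLinearMap.comp_apply, ← map_add,
    hV.adjoint_comp_self hA hB]
  conv_rhs => rw [← hB.sqrt_comp_self]
  rfl

theorem isCovariance_sqrt_opP (hA : IsCovariance A) (hB : IsCovariance B) :
    IsCovariance (opSqrt (opP A B)) := by
  obtain ⟨V, hV⟩ := exists_isPolar hA hB
  refine ⟨sqrt_opP_isPositive hA hB, ?_⟩
  have : opSqrt (opP A B) = (V ∘L opSqrt B) ∘L opSqrt A := by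
    ext x; exact (hV.apply x).symm
  rw [this]
  exact isTraceClass_comp (hB.sqrt_isHilbertSchmidt.comp_left V) hA.sqrt_isHilbertSchmidt

/-- The product G₀*M₀ is exactly P^{1/2}: the Schur term is annihilated by A^{1/2}. -/
theorem properlyAligned_canonicalM (hA : IsCovariance A) (hB : IsCovariance B) :
    ProperlyAligned (opSqrt A) (canonicalM A B) := by
  obtain ⟨V, hV⟩ := exists_isPolar hA hB
  have : (opSqrt A)† ∘L canonicalM A B = opSqrt (opP A B) := by
    ext x
    rw [IsPositive.adjoint_eq' hA.sqrt_isPositive, hV.canonicalM_eq hA hB]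
    simp [sqrt_sqrt_schur hA hB, hV.sqrt_sqrt_adjoint hA hB]
  rw [ProperlyAligned, this]
  exact isCovariance_sqrt_opP hA hB

theorem isTraceClass_canonicalC (hA : IsCovariance A) (hB : IsCovariance B) :
    IsTraceClass (canonicalC A B) :=
  isTraceClass_comp hA.sqrt_isHilbertSchmidt (isGreen_canonicalM hA hB).1.adjoint

end Canonical

/-! ### The Fredholm determinant in a basis -/

section Determinant

universe u

variable {H : Type u} [NormedAddCommGroup H] [InnerProductSpace ℝ H]

theorem finrank_eigenspace {T : H →L[ℝ] H} (hT : (T : H →ₗ[ℝ] H).IsSymmetric) {ι : Type*}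
    (b : HilbertBasis ι ℝ H) {d : ι → ℝ} (hb : ∀ i, T (b i) = d i • b i) (κ : ℝ)
    [Fintype {i // d i = κ}] :
    Module.finrank ℝ (Module.End.eigenspace (T : H →ₗ[ℝ] H) κ) = Fintype.card {i // d i = κ} := by
  have hli : LinearIndependent ℝ fun i : {i // d i = κ} => b i :=
    b.orthonormal.linearIndependent.comp _ Subtype.val_injective
  rw [← finrank_span_eq_card hli]
  have key : Module.End.eigenspace (T : H →ₗ[ℝ] H) κ =
      Submodule.span ℝ (Set.range fun i : {i // d i = κ} => b i) := ?_
  · rw [key]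
  apply le_antisymm
  · intro x hx
    have hx' : T x = κ • x := Module.End.mem_eigenspace_iff.1 hx
    have h0 : ∀ i, d i ≠ κ → inner ℝ (b i) x = 0 := fun i hi => by
      have h := hT (b i) x
      simp only [ContinuousLinearMap.coe_coe, hb, hx', real_inner_smul_left,
        inner_smul_right] at h
      by_contra hne
      exact hi (mul_right_cancel₀ hne h)
    have hsum := b.hasSum_repr x
    have hfin : (Set.univ : Set {i // d i = κ}).Finite := Set.finite_univ
    classical
    have hs2 := hasSum_sum_of_ne_finset_zero (L := SummationFilter.unconditional ι) (f := fun i => b.repr x i • b i)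
      (s := (Finset.univ : Finset {i // d i = κ}).map (Function.Embedding.subtype _))
      (fun i hi => by
        have : d i ≠ κ := fun h => hi (by simp [h])
        rw [b.repr_apply_apply, h0 i this, zero_smul])
    rw [hsum.unique hs2, Finset.sum_map]
    exact Submodule.sum_mem _ fun i _ => Submodule.smul_mem _ _ (Submodule.subset_span ⟨i, rfl⟩)
  · rw [Submodule.span_le]
    rintro _ ⟨i, rfl⟩
    refine Module.End.mem_eigenspace_iff.2 ?_
    rw [ContinuousLinearMap.coe_coe, hb, i.2]

variable [CompleteSpace H]

/-- The sum over an eigenbasis is grouped by the value of the eigenvalue; summability makes each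
group with κ ≠ 0 finite, of size the multiplicity. -/
theorem log_fredholmDet {T : H →L[ℝ] H} (hT : (T : H →ₗ[ℝ] H).IsSymmetric) {ι : Type*}
    (b : HilbertBasis ι ℝ H) {d : ι → ℝ} (hb : ∀ i, T (b i) = d i • b i) (hd : ∀ i, 0 < 1 + d i)
    (hs : Summable d) :
    Real.log (fredholmDet T) = ∑' i, Real.log (1 + d i) := by
  have hlog : Summable fun i => Real.log (1 + d i) := Real.summable_log_one_add_of_summable hs
  have hfib := hlog.hasSum.tsum_fiberwise d
  have hprod := hfib.rexp
  have hterm : ∀ κ : ℝ, Real.exp (∑' i : d ⁻¹' {κ}, Real.log (1 + d i)) =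
      (1 + κ) ^ Module.finrank ℝ (Module.End.eigenspace (T : H →ₗ[ℝ] H) κ) := fun κ => by
    have h1 : ∀ i : d ⁻¹' {κ}, Real.log (1 + d i) = Real.log (1 + κ) := fun i => by rw [i.2]
    simp only [h1]
    -- The group of κ = 0 may be infinite, but all its logarithms are 0 and the factor is a power of
    -- 1.
    rcases eq_or_ne κ 0 with rfl | hκ
    · simp
    have hfin : (d ⁻¹' {κ}).Finite := by
      have h := hs.tendsto_cofinite_zero.eventually_ne (Ne.symm hκ)
      simpa [Filter.eventually_cofinite, Set.preimage] using h
    have : Fintype {i // d i = κ} := hfin.fintype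
    rw [finrank_eigenspace hT b hb κ, tsum_const]
    change Real.exp (Nat.card {i // d i = κ} • _) = _
    rw [Nat.card_eq_fintype_card]
    by_cases hc : Fintype.card {i // d i = κ} = 0
    · rw [hc]; simp
    · obtain ⟨i⟩ := Fintype.card_pos_iff.1 (Nat.pos_of_ne_zero hc)
      have : 0 < 1 + κ := by rw [← i.2]; exact hd i
      rw [nsmul_eq_mul, Real.exp_nat_mul, Real.exp_log this]
  have : fredholmDet T = Real.exp (∑' i, Real.log (1 + d i)) := by
    rw [fredholmDet, ← hprod.tprod_eq]
    exact tprod_congr fun κ => (hterm κ).symm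
  rw [this, Real.log_exp]

theorem log_fredholmDet_neg {R : H →L[ℝ] H} (hR : IsHilbertSchmidt R) (hn : ‖R‖ < 1) {ι : Type*}
    (b : HilbertBasis ι ℝ H) {d : ι → ℝ} (hb : ∀ i, (R†) (R (b i)) = d i • b i) :
    Real.log (fredholmDet (-(R† ∘L R))) = ∑' i, Real.log (1 - ‖R (b i)‖ ^ 2) := by
  have hd : ∀ i, d i = ‖R (b i)‖ ^ 2 := fun i => by
    rw [← real_inner_self_eq_norm_sq, ← ContinuousLinearMap.adjoint_inner_right, hb,
      inner_smul_right, inner_basis_self, mul_one]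
  have hsym : ((-(R† ∘L R) : H →L[ℝ] H) : H →ₗ[ℝ] H).IsSymmetric := by
    intro x y
    have := (ContinuousLinearMap.isPositive_adjoint_comp_self R).isSymmetric x y
    simpa using this
  have := log_fredholmDet hsym b (d := fun i => - ‖R (b i)‖ ^ 2) (fun i => ?_) (fun i => ?_)
    (hR.summable b).neg
  · simpa only [← sub_eq_add_neg] using this
  · rw [← hd, neg_smul, ← hb]; rfl
  · have h1 : ‖R (b i)‖ ≤ ‖R‖ := by simpa [b.orthonormal.1 i] using R.le_opNorm (b i)
    nlinarith [norm_nonneg (R (b i))]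

theorem norm_apply_basis_le {F : Type*} [NormedAddCommGroup F] [NormedSpace ℝ F] (R : H →L[ℝ] F)
    {ι : Type*} (b : HilbertBasis ι ℝ H) (i : ι) : ‖R (b i)‖ ≤ ‖R‖ := by
  simpa [b.orthonormal.1 i] using R.le_opNorm (b i)

theorem summable_log_one_sub {R : H →L[ℝ] H} (hR : IsHilbertSchmidt R) {ι : Type*}
    (b : HilbertBasis ι ℝ H) : Summable fun i => Real.log (1 - ‖R (b i)‖ ^ 2) := by
  simpa only [← sub_eq_add_neg] using Real.summable_log_one_add_of_summable (hR.summable b).neg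

/-- Jensen's inequality for the logarithm of the determinant. -/
theorem log_fredholmDet_neg_le {R : H →L[ℝ] H} (hR : IsHilbertSchmidt R) (hn : ‖R‖ < 1) {ι : Type*}
    (f : HilbertBasis ι ℝ H) :
    Real.log (fredholmDet (-(R† ∘L R))) ≤ ∑' i, Real.log (1 - ‖R (f i)‖ ^ 2) := by
  have hc : IsCompactOperator (R† ∘L R) := (hR.comp_left _).isCompactOperator
  obtain ⟨κ, h, d, hd⟩ := exists_eigenbasis hc
    (ContinuousLinearMap.isPositive_adjoint_comp_self R).isSymmetric
  rw [log_fredholmDet_neg hR hn h hd]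
  have hdn : ∀ i, d i = ‖R (h i)‖ ^ 2 := fun i => by
    rw [← real_inner_self_eq_norm_sq, ← ContinuousLinearMap.adjoint_inner_right]
    change _ = inner ℝ (h i) ((R† ∘L R) (h i))
    rw [hd, inner_smul_right, inner_basis_self, mul_one]
  set L : κ → ℝ := fun j => Real.log (1 - ‖R (h j)‖ ^ 2) with hL
  have hlt : ∀ {x : H}, ‖x‖ = 1 → 0 < 1 - ‖R x‖ ^ 2 := fun {x} hx => by
    have := R.le_opNorm x
    rw [hx, mul_one] at this
    nlinarith [norm_nonneg (R x)]
  have hLs : Summable L := summable_log_one_sub hR h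
  have hw : ∀ j, HasSum (fun i => inner ℝ (f i) (h j) ^ 2) 1 := fun j => by
    simpa [h.orthonormal.1 j] using hasSum_inner_sq f (h j)
  have hw' : ∀ i, HasSum (fun j => inner ℝ (h j) (f i) ^ 2) 1 := fun i => by
    simpa [f.orthonormal.1 i] using hasSum_inner_sq h (f i)
  -- The weights ⟨f_i, h_j⟩² are doubly stochastic. Summing first over i recovers the
  -- log-determinant from the eigenbasis h of R*R; summing first over j gives, for each f_i, a
  -- weighted mean of logarithms.
  have hprod : Summable fun p : κ × ι => inner ℝ (f p.2) (h p.1) ^ 2 * L p.1 := by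
    rw [← summable_abs_iff]
    refine (summable_prod_of_nonneg (fun p => abs_nonneg _)).2 ⟨fun j => ?_, ?_⟩
    · simp only [abs_mul, abs_sq]
      exact (hw j).summable.mul_right _
    · simp only [abs_mul, abs_sq, tsum_mul_right, (hw _).tsum_eq, one_mul]
      exact hLs.abs
  have h1 : ∀ j, HasSum (fun i => inner ℝ (f i) (h j) ^ 2 * L j) (L j) := fun j => by
    simpa using (hw j).mul_right (L j)
  have h2 : ∀ i, HasSum (fun j => inner ℝ (f i) (h j) ^ 2 * L j)
      (∑' j, inner ℝ (f i) (h j) ^ 2 * L j) := fun i =>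
    (((Equiv.prodComm ι κ).summable_iff.2 hprod).prod_factor i).hasSum
  have h3 := hprod.hasSum.prod_fiberwise h1
  have h4 := ((Equiv.prodComm ι κ).hasSum_iff.2 hprod.hasSum).prod_fiberwise h2
  rw [h3.tsum_eq, ← h4.tsum_eq]
  refine h4.summable.tsum_le_tsum (fun i => ?_) (summable_log_one_sub hR f)
  have hm := hlt (f.orthonormal.1 i)
  have hRf : HasSum (fun j => inner ℝ (f i) (h j) ^ 2 * ‖R (h j)‖ ^ 2) (‖R (f i)‖ ^ 2) := by
    have := h.hasSum_inner_mul_inner (f i) ((R† ∘L R) (f i))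
    rw [ContinuousLinearMap.comp_apply, ContinuousLinearMap.adjoint_inner_right,
      real_inner_self_eq_norm_sq] at this
    rw [show (fun j => inner ℝ (f i) (h j) ^ 2 * ‖R (h j)‖ ^ 2) = fun j =>
      inner ℝ (f i) (h j) * inner ℝ (h j) ((R†) (R (f i))) from funext fun j => ?_]
    · exact this
    · have h5 := (ContinuousLinearMap.isPositive_adjoint_comp_self R).inner_left_eq_inner_right
        (h j) (f i)
      rw [hd, real_inner_smul_left, hdn, real_inner_comm] at h5
      rw [ContinuousLinearMap.comp_apply] at h5
      rw [← h5]; ring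
  set m := 1 - ‖R (f i)‖ ^ 2
  have hone : HasSum (fun j => inner ℝ (f i) (h j) ^ 2) 1 := by
    simpa only [real_inner_comm (f i)] using hw' i
  -- Jensen through the tangent of log at m: log x ≤ log m - 1 + x/m, averaged with weights of total
  -- mass 1 under which 1 - ‖R h_j‖² has mean m.
  have hup : HasSum (fun j => inner ℝ (f i) (h j) ^ 2 * (Real.log m - 1) +
      (inner ℝ (f i) (h j) ^ 2 - inner ℝ (f i) (h j) ^ 2 * ‖R (h j)‖ ^ 2) * m⁻¹)
      (1 * (Real.log m - 1) + m * m⁻¹) :=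
    (hone.mul_right _).add ((hone.sub hRf).mul_right _)
  have hle := hasSum_le (fun j => ?_) (h2 i) hup
  · rw [mul_inv_cancel₀ hm.ne'] at hle
    linarith
  · have hx := hlt (h.orthonormal.1 j)
    have h6 := Real.log_le_sub_one_of_pos (mul_pos hx (inv_pos.2 hm))
    rw [Real.log_mul hx.ne' (inv_pos.2 hm).ne', Real.log_inv] at h6
    calc inner ℝ (f i) (h j) ^ 2 * L j
        ≤ inner ℝ (f i) (h j) ^ 2 * (Real.log m - 1 + (1 - ‖R (h j)‖ ^ 2) * m⁻¹) := by
          refine mul_le_mul_of_nonneg_left ?_ (sq_nonneg _)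
          simp only [hL]; linarith
      _ = _ := by ring

end Determinant

/-! ### The one-vector entropic problem -/

section Scalar

/-- The positive solution `c` of `l c² + ε c = 1`. -/
noncomputable def shrink (ε l : ℝ) : ℝ := 2 / (ε + √(ε ^ 2 + 4 * l))

variable {ε l : ℝ}

theorem shrink_pos (hε : 0 < ε) : 0 < shrink ε l := by unfold shrink; positivity

theorem shrink_eq (hε : 0 < ε) (hl : 0 ≤ l) : l * shrink ε l ^ 2 = 1 - ε * shrink ε l := by
  have hs : √(ε ^ 2 + 4 * l) ^ 2 = ε ^ 2 + 4 * l := Real.sq_sqrt (by positivity)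
  have hp : 0 < ε + √(ε ^ 2 + 4 * l) := by positivity
  unfold shrink
  generalize √(ε ^ 2 + 4 * l) = r at *
  field_simp
  nlinarith

theorem shrink_le (hε : 0 < ε) : shrink ε l ≤ 2 / ε := by
  unfold shrink
  gcongr
  linarith [Real.sqrt_nonneg (ε ^ 2 + 4 * l)]

theorem shrink_anti (hε : 0 < ε) {m : ℝ} (h : l ≤ m) : shrink ε m ≤ shrink ε l := by
  unfold shrink
  gcongr

theorem tendsto_sqrt_mul_shrink (hl : 0 < l) :
    Tendsto (fun ε => √l * shrink ε l) (𝓝[>] 0) (𝓝 1) := by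
  have h1 : Continuous fun ε : ℝ => ε + √(ε ^ 2 + 4 * l) := by fun_prop
  have h2 : Tendsto (fun ε : ℝ => ε + √(ε ^ 2 + 4 * l)) (𝓝[>] 0) (𝓝 (2 * √l)) := by
    have := h1.tendsto 0
    rw [show (0 : ℝ) + √(0 ^ 2 + 4 * l) = 2 * √l by
      rw [zero_add, show (0 : ℝ) ^ 2 + 4 * l = 2 ^ 2 * l by ring,
        Real.sqrt_mul (by norm_num), Real.sqrt_sq (by norm_num)]] at this
    exact this.mono_left nhdsWithin_le_nhds
  have h3 : 0 < √l := Real.sqrt_pos.2 hl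
  have h4 := (tendsto_const_nhds (x := √l)).mul ((tendsto_const_nhds (x := (2 : ℝ))).div h2
    (by positivity))
  rw [show √l * (2 / (2 * √l)) = 1 by field_simp] at h4
  exact h4

theorem sqrt_mul_shrink_mem (hε : 0 < ε) (hl : 0 ≤ l) :
    0 ≤ √l * shrink ε l ∧ √l * shrink ε l ≤ 1 := by
  have h1 := shrink_pos (l := l) hε
  refine ⟨by positivity, ?_⟩
  refine abs_le_of_sq_le_sq' ?_ zero_le_one |>.2
  rw [mul_pow, Real.sq_sqrt hl, shrink_eq hε hl]
  nlinarith [mul_pos hε h1]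

variable {E : Type*} [NormedAddCommGroup E] [InnerProductSpace ℝ E]

/-- Strong concavity of `z ↦ 2 ⟨k, z⟩ + ε log (1 - ‖z‖²)` at its maximizer. -/
theorem logBarrier_le {w z k : E} (hε : 0 < ε) (hw : ‖w‖ < 1) (hz : ‖z‖ < 1)
    (hk : (1 - ‖w‖ ^ 2) • k = ε • w) :
    2 * inner ℝ k z + ε * Real.log (1 - ‖z‖ ^ 2) + ε * ‖z - w‖ ^ 2 ≤
      2 * inner ℝ k w + ε * Real.log (1 - ‖w‖ ^ 2) := by
  have hw' : 0 < 1 - ‖w‖ ^ 2 := by nlinarith [norm_nonneg w]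
  have hz' : 0 < 1 - ‖z‖ ^ 2 := by nlinarith [norm_nonneg z]
  have hk' : k = (ε / (1 - ‖w‖ ^ 2)) • w := by
    rw [div_eq_inv_mul, mul_smul, ← hk, smul_smul, inv_mul_cancel₀ hw'.ne', one_smul]
  -- The logarithm is replaced by its tangent at 1 - ‖w‖². By the critical point equation `hk` the
  -- linear terms cancel, leaving -ε‖z - w‖²/(1 - ‖w‖²), which is at most -ε‖z - w‖².
  have h1 := Real.log_le_sub_one_of_pos (mul_pos hz' (inv_pos.2 hw'))
  rw [Real.log_mul hz'.ne' (inv_pos.2 hw').ne', Real.log_inv] at h1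
  have h2 : ‖z - w‖ ^ 2 = ‖z‖ ^ 2 - 2 * inner ℝ w z + ‖w‖ ^ 2 := by
    rw [norm_sub_sq_real, real_inner_comm]
  have h3 : ‖z - w‖ ^ 2 ≤ ‖z - w‖ ^ 2 * (1 - ‖w‖ ^ 2)⁻¹ := by
    refine le_mul_of_one_le_right (sq_nonneg _) ?_
    exact (one_le_inv₀ hw').2 (by nlinarith [sq_nonneg ‖w‖])
  rw [hk', real_inner_smul_left, real_inner_smul_left, real_inner_self_eq_norm_sq, div_eq_mul_inv]
  have h4 : (1 - ‖z‖ ^ 2) * (1 - ‖w‖ ^ 2)⁻¹ - 1 + ‖z - w‖ ^ 2 * (1 - ‖w‖ ^ 2)⁻¹ =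
      2 * (‖w‖ ^ 2 - inner ℝ w z) * (1 - ‖w‖ ^ 2)⁻¹ := by
    rw [h2]; field_simp; ring
  have h5 : Real.log (1 - ‖z‖ ^ 2) + ‖z - w‖ ^ 2 ≤ Real.log (1 - ‖w‖ ^ 2) +
      2 * (‖w‖ ^ 2 - inner ℝ w z) * (1 - ‖w‖ ^ 2)⁻¹ := by linarith
  have h6 := mul_le_mul_of_nonneg_left h5 hε.le
  linarith

end Scalar

/-! ### The explicit entropic maximizer -/

section Entropic

universe u

variable {H : Type u} [NormedAddCommGroup H] [InnerProductSpace ℝ H] [CompleteSpace H]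

/-- `f` diagonalizes `K K*` for `K = M* G`, with eigenvalues `l`. -/
structure IsSingularBasis (G M : H →L[ℝ] H) {ι : Type*} (f : HilbertBasis ι ℝ H) (l : ι → ℝ) :
    Prop where
  apply : ∀ i, (M†) (G ((G†) (M (f i)))) = l i • f i

theorem exists_isSingularBasis {G M : H →L[ℝ] H} (hM : IsHilbertSchmidt M) :
    ∃ (ι : Type u) (f : HilbertBasis ι ℝ H) (l : ι → ℝ), IsSingularBasis G M f l := by
  have hc : IsCompactOperator ((G† ∘L M)† ∘L (G† ∘L M)) :=
    ((hM.comp_left _).comp_left _).isCompactOperator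
  obtain ⟨ι, f, l, h⟩ := exists_eigenbasis hc
    (ContinuousLinearMap.isPositive_adjoint_comp_self _).isSymmetric
  refine ⟨ι, f, l, ⟨fun i => ?_⟩⟩
  rw [← h, ContinuousLinearMap.adjoint_comp, ContinuousLinearMap.adjoint_adjoint]
  rfl

namespace IsSingularBasis

variable {G M : H →L[ℝ] H} {ι : Type*} {f : HilbertBasis ι ℝ H} {l : ι → ℝ}

theorem inner_apply (h : IsSingularBasis G M f l) (i : ι) (x : H) :
    inner ℝ ((G†) (M (f i))) ((G†) (M x)) = l i * inner ℝ (f i) x := by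
  rw [ContinuousLinearMap.adjoint_inner_right, ← ContinuousLinearMap.adjoint_inner_left, h.apply,
    real_inner_smul_left]

theorem norm_sq (h : IsSingularBasis G M f l) (i : ι) : ‖(G†) (M (f i))‖ ^ 2 = l i := by
  rw [← real_inner_self_eq_norm_sq, h.inner_apply, inner_basis_self, mul_one]

theorem nonneg (h : IsSingularBasis G M f l) (i : ι) : 0 ≤ l i := h.norm_sq i ▸ sq_nonneg _

theorem le (h : IsSingularBasis G M f l) (i : ι) : l i ≤ ‖G† ∘L M‖ ^ 2 := by
  rw [← h.norm_sq]
  exact pow_le_pow_left₀ (norm_nonneg _) (norm_apply_basis_le (G† ∘L M) f i) 2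

end IsSingularBasis

/-- The hypothesis says weakly that R*R is diagonal in f; the series is Parseval for ⟨x, R*R y⟩. -/
theorem hasSum_inner_of_orthogonal {R : H →L[ℝ] H} {ι : Type*} (f : HilbertBasis ι ℝ H) {d : ι → ℝ}
    (h : ∀ i x, inner ℝ (R (f i)) (R x) = d i * inner ℝ (f i) x) (x y : H) :
    HasSum (fun i => d i * (inner ℝ (f i) x * inner ℝ (f i) y)) (inner ℝ (R x) (R y)) := by
  have := f.hasSum_inner_mul_inner x ((R†) (R y))
  rw [ContinuousLinearMap.adjoint_inner_right] at this
  simp only [ContinuousLinearMap.adjoint_inner_right, h, real_inner_comm (f _) x] at this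
  rw [show (fun i => d i * (inner ℝ (f i) x * inner ℝ (f i) y)) = fun i =>
    inner ℝ (f i) x * (d i * inner ℝ (f i) y) from funext fun i => by ring]
  exact this

/-- `R = K* c(K K*)` for `K = M* G`, where `c = shrink ε`. -/
structure IsShrunk (G M : H →L[ℝ] H) {ι : Type*} (f : HilbertBasis ι ℝ H) (l : ι → ℝ) (ε : ℝ)
    (R : H →L[ℝ] H) : Prop where
  apply_basis : ∀ i, R (f i) = shrink ε (l i) • (G†) (M (f i))
  exists_factor : ∃ N : H →L[ℝ] H, (∀ x, R x = (G†) (M (N x))) ∧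
    ∀ i x, inner ℝ (f i) (N x) = shrink ε (l i) * inner ℝ (f i) x

theorem exists_isShrunk (G M : H →L[ℝ] H) {ι : Type*} (f : HilbertBasis ι ℝ H) (l : ι → ℝ) {ε : ℝ}
    (hε : 0 < ε) : ∃ R, IsShrunk G M f l ε R := by
  obtain ⟨N, hN, hN'⟩ := exists_diagonal f (fun i => shrink ε (l i)) (2 / ε) fun i => by
    rw [abs_of_pos (shrink_pos hε)]; exact shrink_le hε
  refine ⟨G† ∘L M ∘L N, fun i => ?_, N, fun x => rfl, hN⟩
  simp [hN']

namespace IsShrunk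

variable {G M R : H →L[ℝ] H} {ι : Type*} {f : HilbertBasis ι ℝ H} {l : ι → ℝ} {ε : ℝ}

theorem inner_apply (hR : IsShrunk G M f l ε R) (h : IsSingularBasis G M f l) (i : ι) (x : H) :
    inner ℝ (R (f i)) (R x) = (l i * shrink ε (l i) ^ 2) * inner ℝ (f i) x := by
  obtain ⟨N, hN, hN'⟩ := hR.exists_factor
  rw [hR.apply_basis, hN, real_inner_smul_left, h.inner_apply, hN']
  ring

theorem norm_sq (hR : IsShrunk G M f l ε R) (h : IsSingularBasis G M f l) (hε : 0 < ε) (i : ι) :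
    ‖R (f i)‖ ^ 2 = 1 - ε * shrink ε (l i) := by
  rw [← real_inner_self_eq_norm_sq, hR.inner_apply h, inner_basis_self, mul_one,
    shrink_eq hε (h.nonneg i)]

/-- The eigenvalues of R*R are 1 - ε c(l_i). As l_i ≤ ‖G*M‖² and c is decreasing, they stay below 1
by the uniform margin ε c(‖G*M‖²). -/
theorem norm_lt_one (hR : IsShrunk G M f l ε R) (h : IsSingularBasis G M f l) (hε : 0 < ε) :
    ‖R‖ < 1 := by
  set δ := ε * shrink ε (‖G† ∘L M‖ ^ 2)
  have hδ : 0 < δ := mul_pos hε (shrink_pos hε)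
  have hle : ∀ i, l i * shrink ε (l i) ^ 2 ≤ 1 - δ := fun i => by
    rw [shrink_eq hε (h.nonneg i)]
    have := mul_le_mul_of_nonneg_left (shrink_anti hε (h.le i)) hε.le
    linarith
  have hbd : ∀ x, ‖R x‖ ^ 2 ≤ (1 - δ) * ‖x‖ ^ 2 := fun x => by
    have h1 := hasSum_inner_of_orthogonal f (hR.inner_apply h) x x
    rw [real_inner_self_eq_norm_sq] at h1
    refine hasSum_le (fun i => ?_) h1 ((hasSum_inner_sq f x).mul_left (1 - δ))
    rw [← sq]
    exact mul_le_mul_of_nonneg_right (hle i) (sq_nonneg _)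
  have h2 : ‖R‖ ≤ √(1 - δ) := by
    refine R.opNorm_le_bound (Real.sqrt_nonneg _) fun x => ?_
    rw [← Real.sqrt_sq (norm_nonneg x), ← Real.sqrt_mul' _ (sq_nonneg _)]
    exact Real.le_sqrt_of_sq_le (hbd x)
  refine h2.trans_lt ?_
  rw [Real.sqrt_lt' one_pos]
  linarith

theorem isHilbertSchmidt (hR : IsShrunk G M f l ε R) (hM : IsHilbertSchmidt M) :
    IsHilbertSchmidt R := by
  obtain ⟨N, hN, -⟩ := hR.exists_factor
  rw [show R = G† ∘L (M ∘L N) from ContinuousLinearMap.ext hN]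
  exact (hM.comp_right N).comp_left _

theorem mem_admissible (hR : IsShrunk G M f l ε R) (h : IsSingularBasis G M f l) (hε : 0 < ε)
    (hM : IsHilbertSchmidt M) : R ∈ admissible G M := by
  refine ⟨hR.isHilbertSchmidt hM, fun x hx => ?_, ?_, hR.norm_lt_one h hε⟩
  · have hx' : M x = 0 := hx
    have h0 : ∀ i, l i * inner ℝ (f i) x = 0 := fun i => by
      rw [← h.inner_apply, hx', map_zero, inner_zero_right]
    have h1 := hasSum_inner_of_orthogonal f (hR.inner_apply h) x x
    rw [show (fun i => l i * shrink ε (l i) ^ 2 * (inner ℝ (f i) x * inner ℝ (f i) x)) = fun _ => 0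
      from funext fun i => by linear_combination shrink ε (l i) ^ 2 * inner ℝ (f i) x * h0 i] at h1
    exact inner_self_eq_zero.1 (h1.unique hasSum_zero)
  · rintro _ ⟨x, rfl⟩ z hz
    obtain ⟨N, hN, -⟩ := hR.exists_factor
    have hz' : G z = 0 := hz
    change inner ℝ z (R x) = 0
    rw [hN, ContinuousLinearMap.adjoint_inner_right, hz', inner_zero_left]

/-- In the basis f the trace is a sum over i for both operators. The log-determinant is such a sum
for R, whose R*R is diagonal in f, and is bounded by one for R'. Strong concavity applied term by
term then gives existence and uniqueness together. -/
theorem profit_gap (hR : IsShrunk G M f l ε R) (h : IsSingularBasis G M f l) (hε : 0 < ε)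
    (hM : IsHilbertSchmidt M) {R' : H →L[ℝ] H} (hR' : R' ∈ admissible G M) :
    Summable (fun i => ‖R' (f i) - R (f i)‖ ^ 2) ∧
      profit G M ε R' + ε * ∑' i, ‖R' (f i) - R (f i)‖ ^ 2 ≤ profit G M ε R := by
  have hK : IsHilbertSchmidt (M† ∘L G) := hM.adjoint.comp_right G
  have hRHS := hR.isHilbertSchmidt hM
  have hRn := hR.norm_lt_one h hε
  obtain ⟨hHS, -, -, hn⟩ := hR'
  have htr : ∀ {S : H →L[ℝ] H}, IsHilbertSchmidt S →
      HasSum (fun i => inner ℝ ((G†) (M (f i))) (S (f i))) (trace (S ∘L M† ∘L G)) := fun {S} hS => by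
    have := hasSum_trace_comp f hS hK
    simpa only [ContinuousLinearMap.comp_apply, ContinuousLinearMap.adjoint_inner_right,
      ContinuousLinearMap.adjoint_inner_left] using this
  have hdet : Real.log (fredholmDet (-(R† ∘L R))) = ∑' i, Real.log (1 - ‖R (f i)‖ ^ 2) := by
    refine log_fredholmDet_neg hRHS hRn f (d := fun i => l i * shrink ε (l i) ^ 2) fun i => ?_
    refine ext_inner_right ℝ fun y => ?_
    rw [ContinuousLinearMap.adjoint_inner_left, hR.inner_apply h, real_inner_smul_left]
  have hdet' := log_fredholmDet_neg_le hHS hn f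
  have hgap : Summable fun i => ‖R' (f i) - R (f i)‖ ^ 2 := by
    have hle : ∀ i, ‖R' (f i) - R (f i)‖ ^ 2 ≤ 2 * ‖R' (f i)‖ ^ 2 + 2 * ‖R (f i)‖ ^ 2 := fun i => by
      have h1 := norm_sub_le (R' (f i)) (R (f i))
      nlinarith [norm_nonneg (R' (f i) - R (f i)), sq_nonneg (‖R' (f i)‖ - ‖R (f i)‖)]
    exact Summable.of_nonneg_of_le (fun i => sq_nonneg _) hle
      (((hHS.summable f).mul_left 2).add ((hRHS.summable f).mul_left 2))
  refine ⟨hgap, ?_⟩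
  have hsum := ((htr hHS).mul_left 2).add ((summable_log_one_sub hHS f).hasSum.mul_left ε) |>.add
    (hgap.hasSum.mul_left ε)
  have hsum' := ((htr hRHS).mul_left 2).add ((summable_log_one_sub hRHS f).hasSum.mul_left ε)
  have hle := hasSum_le (fun i => ?_) hsum hsum'
  · rw [profit, profit, hdet]
    have := mul_le_mul_of_nonneg_left hdet' hε.le
    linarith
  · refine logBarrier_le hε ((norm_apply_basis_le R f i).trans_lt hRn)
      ((norm_apply_basis_le R' f i).trans_lt hn) ?_
    rw [hR.norm_sq h hε, hR.apply_basis, smul_smul]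
    congr 1
    ring

theorem isOptimalCorrelation (hR : IsShrunk G M f l ε R) (h : IsSingularBasis G M f l) (hε : 0 < ε)
    (hM : IsHilbertSchmidt M) : IsOptimalCorrelation G M ε R := by
  refine ⟨hR.mem_admissible h hε hM, fun R' hR' => ?_⟩
  have hg := (hR.profit_gap h hε hM hR').2
  have : 0 ≤ ε * ∑' i, ‖R' (f i) - R (f i)‖ ^ 2 :=
    mul_nonneg hε.le (tsum_nonneg fun i => sq_nonneg _)
  change profit G M ε R' ≤ profit G M ε R
  linarith

theorem eq_of_isOptimalCorrelation (hR : IsShrunk G M f l ε R) (h : IsSingularBasis G M f l)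
    (hε : 0 < ε) (hM : IsHilbertSchmidt M) {R' : H →L[ℝ] H} (hR' : IsOptimalCorrelation G M ε R') :
    R' = R := by
  obtain ⟨hs, hg⟩ := hR.profit_gap h hε hM hR'.1
  have hmax : profit G M ε R ≤ profit G M ε R' := hR'.2 (hR.mem_admissible h hε hM)
  have h0 : ∑' i, ‖R' (f i) - R (f i)‖ ^ 2 ≤ 0 := by
    by_contra! hpos
    nlinarith [mul_pos hε hpos]
  refine clm_ext_basis f fun i => ?_
  have h1 := (hs.le_tsum i fun j _ => sq_nonneg _).trans h0
  have h2 : ‖R' (f i) - R (f i)‖ = 0 :=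
    pow_eq_zero_iff two_ne_zero |>.1 (le_antisymm h1 (sq_nonneg _))
  exact sub_eq_zero.1 (norm_eq_zero.1 h2)

end IsShrunk

end Entropic

/-! ### The limit correlation and trace norm convergence -/

section Limit

universe u

variable {H : Type u} [NormedAddCommGroup H] [InnerProductSpace ℝ H] [CompleteSpace H]

theorem isPositive_diagonal_adjoint {N : H →L[ℝ] H} {ι : Type*} {f : HilbertBasis ι ℝ H}
    {d : ι → ℝ} (hN : ∀ i x, inner ℝ (f i) (N x) = d i * inner ℝ (f i) x) : N† = N := by
  refine ContinuousLinearMap.ext fun x => ext_inner_basis f fun i => ?_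
  have hb : N (f i) = d i • f i := ext_inner_basis f fun j => by
    rw [hN, inner_smul_right]
    rcases eq_or_ne j i with rfl | h
    · rfl
    · simp [inner_basis_of_ne f h]
  rw [ContinuousLinearMap.adjoint_inner_right, hb, hN, real_inner_smul_left]

/-- `W` is the partial isometry of the polar decomposition of `G* M`. -/
structure IsLimitCorrelation (G M : H →L[ℝ] H) {ι : Type*} (f : HilbertBasis ι ℝ H) (l : ι → ℝ)
    (W : H →L[ℝ] H) : Prop where
  apply_basis : ∀ i, √(l i) • W (f i) = (G†) (M (f i))
  apply_basis_of_eq_zero : ∀ i, l i = 0 → W (f i) = 0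
  norm_le : ∀ z, ‖W z‖ ≤ ‖z‖
  inner_apply : ∀ i x, inner ℝ (W (f i)) (W x) = (if l i = 0 then 0 else 1) * inner ℝ (f i) x
  isPositive : (W ∘L M† ∘L G).IsPositive
  vanish : ∀ z, (G†) (M z) = 0 → W z = 0
  adjoint_comp : ∀ x, (W†) (W ((M†) (G x))) = (M†) (G x)
  adjoint_vanish : ∀ z, G z = 0 → (W†) z = 0

/-- With Y = |G*M|, diagonal in f with entries √l_i, the factorization G*M = W Y gives W M*G = W Y
W*, which is positive. -/
theorem IsSingularBasis.exists_isLimitCorrelation {G M : H →L[ℝ] H} {ι : Type*}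
    {f : HilbertBasis ι ℝ H} {l : ι → ℝ} (h : IsSingularBasis G M f l) :
    ∃ W, IsLimitCorrelation G M f l W := by
  obtain ⟨Y, hY, hYf⟩ := exists_diagonal f (fun i => √(l i)) ‖G† ∘L M‖ fun i => by
    rw [abs_of_nonneg (Real.sqrt_nonneg _)]
    exact Real.sqrt_le_left (norm_nonneg _) |>.2 (h.le i)
  have hYadj : Y† = Y := isPositive_diagonal_adjoint hY
  have hYpos : Y.IsPositive := isPositive_of_diagonal f hY fun i => Real.sqrt_nonneg _
  have hn : ∀ x, ‖(G† ∘L M) x‖ = ‖Y x‖ := fun x => by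
    have h1 := hasSum_inner_of_orthogonal (R := G† ∘L M) f h.inner_apply x x
    have h2 := hasSum_inner_of_orthogonal (R := Y) f (d := l) (fun i x => by
      rw [hYf, real_inner_smul_left, hY, ← mul_assoc, Real.mul_self_sqrt (h.nonneg i)]) x x
    have h3 := h1.unique h2
    rw [real_inner_self_eq_norm_sq, real_inner_self_eq_norm_sq] at h3
    exact (pow_left_inj₀ (norm_nonneg _) (norm_nonneg _) two_ne_zero).1 h3
  obtain ⟨W, h1, h2, h3, h4⟩ := exists_partialIsometry (G† ∘L M) Y hn
  have hX : (G† ∘L M)† = M† ∘L G := by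
    rw [ContinuousLinearMap.adjoint_comp, ContinuousLinearMap.adjoint_adjoint]
  have hXY : M† ∘L G = Y ∘L W† := by
    rw [← hX, show G† ∘L M = W ∘L Y from ContinuousLinearMap.ext fun x => (h1 x).symm,
      ContinuousLinearMap.adjoint_comp, hYadj]
  have hXY' : ∀ x, (M†) (G x) = Y ((W†) x) := fun x => DFunLike.congr_fun hXY x
  have hWY : ∀ x, (W†) (W (Y x)) = Y x := fun x => by rw [h1, h2]
  have hb : ∀ i, √(l i) • W (f i) = (G†) (M (f i)) := fun i => by
    rw [← map_smul, ← hYf, h1]; rfl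
  have hb0 : ∀ i, l i = 0 → W (f i) = 0 := fun i hi => h4 _ (by
    rw [hYadj, hYf, hi, Real.sqrt_zero, zero_smul])
  refine ⟨W, hb, hb0, h3, fun i x => ?_, ?_, fun z hz => ?_, fun x => ?_, fun z hz => ?_⟩
  · split_ifs with hi
    · rw [hb0 i hi, inner_zero_left, zero_mul]
    · have hpos : √(l i) ≠ 0 := (Real.sqrt_pos.2 ((h.nonneg i).lt_of_ne' hi)).ne'
      have h5 : (W†) (W (f i)) = f i := by
        have := hWY (f i)
        rw [hYf, map_smul, map_smul] at this
        exact smul_right_injective _ hpos this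
      rw [← ContinuousLinearMap.adjoint_inner_left, h5, one_mul]
  · rw [hXY]
    exact hYpos.conj_adjoint W
  · refine h4 z ?_
    rw [hYadj, ← norm_eq_zero, ← hn]
    simp [hz]
  · rw [hXY', hWY]
  · refine adjoint_vanish_of_partialIsometry h1 h4 ?_
    rw [hX, ContinuousLinearMap.comp_apply, hz, map_zero]

/-- The Green's function form of the canonical cross-covariance. -/
theorem IsLimitCorrelation.comp_eq_canonicalC {A B G M W : H →L[ℝ] H} {ι : Type*}
    {f : HilbertBasis ι ℝ H} {l : ι → ℝ} (hW : IsLimitCorrelation G M f l W)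
    (hA : IsCovariance A) (hB : IsCovariance B) (hG : IsGreen A G) (hM : IsGreen B M) :
    G ∘L W ∘L M† = canonicalC A B := by
  obtain ⟨V, hV⟩ := exists_isPolar hA hB
  -- Partial isometries with G* = g A^{1/2} and, next, M* = m B^{1/2}; they carry W to the polar
  -- factor V of the canonical pair, as g* W m = V.
  obtain ⟨g, hg1, hg2, -, hg4⟩ :=
    exists_partialIsometry (G†) (opSqrt A) (IsGreen.norm_adjoint hA hG.2)
  obtain ⟨m, hm1, hm2, -, hm4⟩ :=
    exists_partialIsometry (M†) (opSqrt B) (IsGreen.norm_adjoint hB hM.2)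
  set a := opSqrt A with ha
  set b := opSqrt B with hb
  have haa : a† = a := IsPositive.adjoint_eq' hA.sqrt_isPositive
  have hbb : b† = b := IsPositive.adjoint_eq' hB.sqrt_isPositive
  have hGag : ∀ x, a ((g†) x) = G x := fun x => by
    have : (g ∘L a)† = G := by
      rw [show g ∘L a = G† from ContinuousLinearMap.ext hg1, ContinuousLinearMap.adjoint_adjoint]
    rw [← this, ContinuousLinearMap.adjoint_comp, haa]; rfl
  have hGg : ∀ x, G (g x) = a x := fun x => by
    have : (g† ∘L G†)† = a† := by
      rw [show g† ∘L G† = a from ContinuousLinearMap.ext hg2]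
    rw [ContinuousLinearMap.adjoint_comp, ContinuousLinearMap.adjoint_adjoint,
      ContinuousLinearMap.adjoint_adjoint, haa] at this
    exact DFunLike.congr_fun this x
  have hMm : ∀ x, M (m x) = b x := fun x => by
    have : (m† ∘L M†)† = b† := by
      rw [show m† ∘L M† = b from ContinuousLinearMap.ext hm2]
    rw [ContinuousLinearMap.adjoint_comp, ContinuousLinearMap.adjoint_adjoint,
      ContinuousLinearMap.adjoint_adjoint, hbb] at this
    exact DFunLike.congr_fun this x
  -- The operator g g* changes z only by an element of ker G, where W* vanishes. Hence g* preserves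
  -- inner products on the range of W.
  have hWgg : ∀ z, (W†) (g ((g†) z)) = (W†) z := fun z => by
    rw [← sub_eq_zero, ← map_sub]
    refine hW.adjoint_vanish _ ?_
    rw [map_sub, hGg, hGag, sub_self]
  have hinner : ∀ u v, inner ℝ ((g†) (W u)) ((g†) (W v)) = inner ℝ (W u) (W v) := fun u v => by
    rw [ContinuousLinearMap.adjoint_inner_right, ← ContinuousLinearMap.adjoint_inner_left W, hWgg,
      ContinuousLinearMap.adjoint_inner_left]
  set S := g† ∘L (W ∘L M† ∘L G) ∘L g with hS
  have hSpos : S.IsPositive := by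
    have := hW.isPositive.adjoint_conj g
    exact this
  have hSapply : ∀ x, S x = (g†) (W ((M†) (a x))) := fun x => by
    rw [← hGg]; rfl
  -- W*W fixes the range of M*G, so W drops out of ⟨S x, S y⟩ and leaves ⟨M*A^{1/2}x, M*A^{1/2}y⟩.
  -- Uniqueness of the root then gives S = P^{1/2}.
  have hSS : S ∘L S = opP A B := by
    refine ContinuousLinearMap.ext fun x => ext_inner_right ℝ fun y => ?_
    have h1 : inner ℝ (W ((M†) (a x))) (W ((M†) (a y))) = inner ℝ ((M†) (a x)) ((M†) (a y)) := by
      rw [← ContinuousLinearMap.adjoint_inner_right, ← hGg y, hW.adjoint_comp]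
    rw [ContinuousLinearMap.comp_apply, IsPositive.inner_comm hSpos, hSapply, hSapply, hinner, h1,
      ContinuousLinearMap.adjoint_inner_right]
    change _ = inner ℝ (a (B (a x))) y
    rw [IsPositive.inner_comm hA.sqrt_isPositive, ← hM.2]
    rfl
  have hSP : opSqrt (opP A B) = S :=
    opSqrt_eq (opP_isCompactOperator hA) (opP_isPositive hA hB) hSpos hSS
  -- Both operators take B^{1/2}A^{1/2}x to P^{1/2}x and vanish on the complement of that range, so
  -- the difference D has range of D* inside ker D, and D D* = 0.
  have hVb : ∀ z, (g†) (W (m z)) = V z := by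
    set D := g† ∘L W ∘L m - V with hD
    have hDker : ∀ z, a (b z) = 0 → D z = 0 := fun z hz => by
      have : W (m z) = 0 := hW.vanish _ (by rw [hMm, ← hg1, hz, map_zero])
      rw [hD, sub_apply, hV.vanish z hz, sub_zero]
      simp [this]
    have hDba : ∀ x, D (b (a x)) = 0 := fun x => by
      rw [hD, sub_apply, hV.apply, hSP, hSapply]
      simp [hm1]
    have hDadj : D† = 0 := by
      refine ContinuousLinearMap.ext fun z => ?_
      have h1 : a (b ((D†) z)) = 0 := ext_inner_right ℝ fun y => by
        rw [IsPositive.inner_comm hA.sqrt_isPositive, IsPositive.inner_comm hB.sqrt_isPositive,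
          ContinuousLinearMap.adjoint_inner_left, hDba, inner_zero_right, inner_zero_left]
      have h2 := hDker _ h1
      refine inner_self_eq_zero (𝕜 := ℝ).1 ?_
      rw [ContinuousLinearMap.adjoint_inner_left, h2, inner_zero_right]
    have hD0 : D = 0 := by
      rw [← ContinuousLinearMap.adjoint_adjoint D, hDadj, map_zero]
    intro z
    have := DFunLike.congr_fun hD0 z
    exact sub_eq_zero.1 this
  rw [hV.canonicalC_eq hA hB]
  ext x
  change G (W ((M†) x)) = a (V (b x))
  rw [← hVb, hm1, hGag]

/-- Dominated convergence with majorant ‖M f_i‖²: no uniformity in i is needed because M is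
Hilbert–Schmidt. -/
theorem tendsto_tsum_mul_sq {M : H →L[ℝ] H} (hM : IsHilbertSchmidt M) {ι : Type*}
    (f : HilbertBasis ι ℝ H) {δ : ℝ → ι → ℝ} (hδ : ∀ ε, 0 < ε → ∀ i, |δ ε i| ≤ 1)
    (h0 : ∀ i, Tendsto (fun ε => δ ε i) (𝓝[>] 0) (𝓝 0)) :
    Tendsto (fun ε => ∑' i, ENNReal.ofReal (‖δ ε i • M (f i)‖ ^ 2)) (𝓝[>] 0) (𝓝 0) := by
  have hbd : ∀ ε, 0 < ε → ∀ i, ‖δ ε i • M (f i)‖ ^ 2 ≤ ‖M (f i)‖ ^ 2 := fun ε hε i => by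
    rw [norm_smul, mul_pow]
    refine mul_le_of_le_one_left (sq_nonneg _) ?_
    rw [Real.norm_eq_abs]
    exact pow_le_one₀ (abs_nonneg _) (hδ ε hε i)
  have hlim : Tendsto (fun ε => ∑' i, ‖δ ε i • M (f i)‖ ^ 2) (𝓝[>] 0) (𝓝 (∑' _ : ι, (0 : ℝ))) := by
    refine tendsto_tsum_of_dominated_convergence (hM.summable f) (fun i => ?_) ?_
    · have := (((h0 i).smul_const (M (f i))).norm).pow 2
      simpa using this
    · filter_upwards [self_mem_nhdsWithin] with ε hε i
      rw [Real.norm_of_nonneg (sq_nonneg _)]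
      exact hbd ε hε i
  rw [tsum_zero] at hlim
  have h := (ENNReal.continuous_ofReal.tendsto 0).comp hlim
  rw [ENNReal.ofReal_zero] at h
  refine h.congr' ?_
  filter_upwards [self_mem_nhdsWithin] with ε hε
  refine ENNReal.ofReal_tsum_of_nonneg (fun i => sq_nonneg _) ?_
  exact Summable.of_nonneg_of_le (fun i => sq_nonneg _) (hbd ε hε) (hM.summable f)

/-- The deviation of the singular values of the entropic correlation from their limit. -/
noncomputable def deviation {ι : Type*} (l : ι → ℝ) (ε : ℝ) (i : ι) : ℝ :=
  if l i = 0 then 0 else √(l i) * shrink ε (l i) - 1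

theorem abs_deviation_le {ι : Type*} {l : ι → ℝ} (hl : ∀ i, 0 ≤ l i) {ε : ℝ} (hε : 0 < ε) (i : ι) :
    |deviation l ε i| ≤ 1 := by
  unfold deviation
  split_ifs
  · simp
  · obtain ⟨h1, h2⟩ := sqrt_mul_shrink_mem hε (hl i)
    rw [abs_le]
    constructor <;> linarith

theorem tendsto_deviation {ι : Type*} {l : ι → ℝ} (hl : ∀ i, 0 ≤ l i) (i : ι) :
    Tendsto (fun ε => deviation l ε i) (𝓝[>] 0) (𝓝 0) := by
  unfold deviation
  split_ifs with h
  · exact tendsto_const_nhds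
  · simpa using (tendsto_sqrt_mul_shrink ((hl i).lt_of_ne' h)).sub_const 1

/-- R - W = W N with N diagonal with entries the deviations. W is a contraction, and N M* has the
Hilbert–Schmidt norm of its adjoint M N. -/
theorem hsSq_sub_comp_adjoint_le {G M R W : H →L[ℝ] H} {ι : Type*} {f : HilbertBasis ι ℝ H}
    {l : ι → ℝ} {ε : ℝ} (h : IsSingularBasis G M f l) (hW : IsLimitCorrelation G M f l W)
    (hε : 0 < ε) (hR : IsShrunk G M f l ε R) :
    hsSq ((R - W) ∘L M†) ≤ ∑' i, ENNReal.ofReal (‖deviation l ε i • M (f i)‖ ^ 2) := by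
  obtain ⟨N, hN, hNf⟩ := exists_diagonal f (deviation l ε) 1 (abs_deviation_le h.nonneg hε)
  have hRW : R - W = W ∘L N := clm_ext_basis f fun i => by
    rw [sub_apply, hR.apply_basis, ContinuousLinearMap.comp_apply, hNf, map_smul,
      ← hW.apply_basis, deviation]
    split_ifs with hi
    · rw [hW.apply_basis_of_eq_zero i hi]; simp
    · rw [smul_smul, sub_smul, one_smul, mul_comm]
  have hle : hsSq ((R - W) ∘L M†) ≤ hsSq (N ∘L M†) := by
    refine ENNReal.tsum_le_tsum fun i => ENNReal.ofReal_le_ofReal ?_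
    refine pow_le_pow_left₀ (norm_nonneg _) ?_ 2
    rw [hRW]
    exact hW.norm_le _
  refine hle.trans (le_of_eq ?_)
  rw [← hsSq_adjoint, ContinuousLinearMap.adjoint_comp, ContinuousLinearMap.adjoint_adjoint,
    isPositive_diagonal_adjoint hN, ← tsum_norm_sq f]
  exact tsum_congr fun i => by rw [ContinuousLinearMap.comp_apply, hNf, map_smul]

/-- The entropic cross-covariances converge to the canonical one in trace norm. -/
theorem tendsto_traceNorm {G M W : H →L[ℝ] H} {ι : Type*} {f : HilbertBasis ι ℝ H}
    {l : ι → ℝ} (h : IsSingularBasis G M f l) (hW : IsLimitCorrelation G M f l W)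
    (hG : IsHilbertSchmidt G) (hM : IsHilbertSchmidt M) {R : ℝ → H →L[ℝ] H}
    (hR : ∀ ε, 0 < ε → IsShrunk G M f l ε (R ε)) :
    Tendsto (fun ε => traceNorm (G ∘L R ε ∘L M† - G ∘L W ∘L M†)) (𝓝[>] 0) (𝓝 0) := by
  have hlim := tendsto_tsum_mul_sq hM f (fun ε hε => abs_deviation_le h.nonneg hε)
    (tendsto_deviation h.nonneg)
  have h1 : Tendsto (fun ε => hsSq G ^ (1 / 2 : ℝ) *
      (∑' i, ENNReal.ofReal (‖deviation l ε i • M (f i)‖ ^ 2)) ^ (1 / 2 : ℝ)) (𝓝[>] 0) (𝓝 0) := by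
    have h2 := ENNReal.Tendsto.const_mul (a := hsSq G ^ (1 / 2 : ℝ)) (hlim.ennrpow_const (1 / 2))
      (Or.inr (ENNReal.rpow_lt_top_of_nonneg (by norm_num) (ne_of_lt hG)).ne)
    rwa [ENNReal.zero_rpow_of_pos (by norm_num), mul_zero] at h2
  refine tendsto_of_tendsto_of_tendsto_of_le_of_le' tendsto_const_nhds h1
    (Eventually.of_forall fun _ => zero_le) ?_
  filter_upwards [self_mem_nhdsWithin] with ε hε
  have he : G ∘L R ε ∘L M† - G ∘L W ∘L M† = G ∘L ((R ε - W) ∘L M†) := by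
    ext x; simp
  rw [he]
  refine (traceNorm_comp_le (hM.adjoint.comp_left _)).trans ?_
  gcongr
  exact hsSq_sub_comp_adjoint_le h hW hε (hR ε hε)

end Limit

/-! ### Gaussian series in a Hilbert space -/

section GaussianSeries

/-- The law of a family of independent standard Gaussian variables. -/
noncomputable def gaussWeights (ι : Type*) : Measure (ι → ℝ) :=
  Measure.infinitePi fun _ => gaussianReal 0 1

instance (ι : Type*) : IsProbabilityMeasure (gaussWeights ι) := by
  unfold gaussWeights; infer_instance

theorem measurePreserving_gaussWeights {ι : Type*} (i : ι) :
    MeasurePreserving (fun ω : ι → ℝ => ω i) (gaussWeights ι) (gaussianReal 0 1) :=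
  measurePreserving_eval_infinitePi _ i

theorem memLp_gaussWeights {ι : Type*} (i : ι) :
    MemLp (fun ω : ι → ℝ => ω i) 2 (gaussWeights ι) :=
  (memLp_id_gaussianReal (μ := 0) (v := 1) 2).comp_measurePreserving (measurePreserving_gaussWeights i)

theorem integral_mul_gaussWeights {ι : Type*} [DecidableEq ι] (i j : ι) :
    ∫ ω, ω i * ω j ∂(gaussWeights ι) = if i = j then 1 else 0 := by
  have h1 : ∀ k : ι, ∫ ω, ω k ∂(gaussWeights ι) = 0 := fun k => by
    rw [← integral_id_gaussianReal (μ := 0) (v := 1), ← (measurePreserving_gaussWeights k).map_eq,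
      integral_map (measurable_pi_apply k).aemeasurable (by fun_prop)]
  split_ifs with h
  · subst h
    have h2 := variance_id_gaussianReal (μ := 0) (v := 1)
    change Var[id; _] = _ at h2
    rw [← (measurePreserving_gaussWeights i).map_eq,
      variance_id_map (measurable_pi_apply i).aemeasurable,
      variance_of_integral_eq_zero (measurable_pi_apply i).aemeasurable (h1 i)] at h2
    simpa [sq] using h2
  · have hind : iIndepFun (fun (k : ι) (ω : ι → ℝ) => ω k) (gaussWeights ι) :=
      iIndepFun_infinitePi (X := fun _ x => x) fun _ => measurable_id
    have := (hind.indepFun h).integral_fun_mul_eq_mul_integral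
      (measurable_pi_apply i).aestronglyMeasurable (measurable_pi_apply j).aestronglyMeasurable
    rw [this, h1, zero_mul]

variable {ι : Type*} {E : Type*} [NormedAddCommGroup E] [InnerProductSpace ℝ E]

theorem memLp_gaussTerm (i : ι) (v : E) :
    MemLp (fun ω : ι → ℝ => ω i • v) 2 (gaussWeights ι) :=
  (ContinuousLinearMap.toSpanSingleton ℝ v).comp_memLp' (memLp_gaussWeights i)

/-- The random vector `ξ_i v`. -/
noncomputable def gaussTerm (i : ι) (v : E) : Lp E 2 (gaussWeights ι) := (memLp_gaussTerm i v).toLp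

theorem inner_gaussTerm [DecidableEq ι] (i j : ι) (v w : E) :
    inner ℝ (gaussTerm i v) (gaussTerm j w) = if i = j then inner ℝ v w else 0 := by
  rw [L2.inner_def]
  have : (fun ω => inner ℝ (gaussTerm i v ω) (gaussTerm j w ω)) =ᵐ[gaussWeights ι]
      fun ω => (ω i * ω j) * inner ℝ v w := by
    filter_upwards [(memLp_gaussTerm i v).coeFn_toLp, (memLp_gaussTerm j w).coeFn_toLp] with ω h1 h2
    rw [gaussTerm, gaussTerm, h1, h2, real_inner_smul_left, inner_smul_right]
    ring
  rw [integral_congr_ae this, integral_mul_const, integral_mul_gaussWeights]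
  split_ifs <;> simp

theorem gaussTerm_sub (i : ι) (v w : E) : gaussTerm i (v - w) = gaussTerm i v - gaussTerm i w := by
  rw [gaussTerm, gaussTerm, gaussTerm, ← MemLp.toLp_sub]
  congr 1
  ext ω
  simp [smul_sub]

theorem norm_sum_gaussTerm_sq (v : ι → E) (s : Finset ι) :
    ‖∑ i ∈ s, gaussTerm i (v i)‖ ^ 2 = ∑ i ∈ s, ‖v i‖ ^ 2 := by
  classical
  rw [← real_inner_self_eq_norm_sq, sum_inner]
  refine Finset.sum_congr rfl fun i hi => ?_
  rw [inner_sum]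
  simp [inner_gaussTerm, hi]

/-- The terms are orthogonal in L², so the Cauchy criterion reduces to that of ∑ ‖v_i‖². -/
theorem summable_gaussTerm [CompleteSpace E] {v : ι → E} (hv : Summable fun i => ‖v i‖ ^ 2) :
    Summable fun i => gaussTerm i (v i) := by
  rw [summable_iff_vanishing_norm]
  intro ε hε
  obtain ⟨s, hs⟩ := summable_iff_vanishing_norm.1 hv (ε ^ 2) (by positivity)
  refine ⟨s, fun t ht => ?_⟩
  have h := hs t ht
  rw [← norm_sum_gaussTerm_sq, Real.norm_of_nonneg (sq_nonneg _)] at h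
  exact lt_of_pow_lt_pow_left₀ 2 hε.le h

/-- The random vector `∑ ξ_i v_i`. -/
noncomputable def gaussSeries (v : ι → E) : Lp E 2 (gaussWeights ι) := ∑' i, gaussTerm i (v i)

variable [CompleteSpace E]

theorem norm_gaussSeries_sq {v : ι → E} (hv : Summable fun i => ‖v i‖ ^ 2) :
    ‖gaussSeries v‖ ^ 2 = ∑' i, ‖v i‖ ^ 2 := by
  have h1 := ((summable_gaussTerm hv).hasSum.norm.pow 2)
  simp only [norm_sum_gaussTerm_sq] at h1
  exact tendsto_nhds_unique h1 hv.hasSum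

theorem gaussSeries_sub {v w : ι → E} (hv : Summable fun i => ‖v i‖ ^ 2)
    (hw : Summable fun i => ‖w i‖ ^ 2) :
    gaussSeries v - gaussSeries w = gaussSeries (v - w) := by
  rw [gaussSeries, gaussSeries, ← (summable_gaussTerm hv).tsum_sub (summable_gaussTerm hw)]
  exact tsum_congr fun i => (gaussTerm_sub i _ _).symm

variable [MeasurableSpace E] [BorelSpace E] [SecondCountableTopology E]

theorem charFun_sum_gaussTerm (v : ι → E) (s : Finset ι) (t : E) :
    charFun ((gaussWeights ι).map (∑ i ∈ s, fun ω : ι → ℝ => ω i • v i)) t =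
      Complex.exp (-((∑ i ∈ s, inner ℝ t (v i) ^ 2 : ℝ) : ℂ) / 2) := by
  have hind : iIndepFun (fun (k : ι) (ω : ι → ℝ) => ω k • v k) (gaussWeights ι) :=
    iIndepFun_infinitePi (X := fun k x => x • v k) fun _ => by fun_prop
  have hmeas : ∀ i, AEMeasurable (fun ω : ι → ℝ => ω i • v i) (gaussWeights ι) := fun i =>
    ((measurable_pi_apply i).smul_const (v i)).aemeasurable
  rw [iIndepFun.charFun_map_finsetSum_eq_prod (fun i _ => hmeas i)
    (hind.precomp (g := (Subtype.val : s → ι)) Subtype.val_injective), Finset.prod_apply]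
  have h1 : ∀ i, charFun ((gaussWeights ι).map fun ω : ι → ℝ => ω i • v i) t =
      Complex.exp (-((inner ℝ t (v i) ^ 2 : ℝ) : ℂ) / 2) := fun i => by
    have h2 := charFun_gaussianReal (μ := 0) (v := 1) (inner ℝ t (v i))
    rw [← (measurePreserving_gaussWeights i).map_eq, charFun_apply,
      integral_map (measurable_pi_apply i).aemeasurable (by fun_prop)] at h2
    rw [charFun_apply, integral_map (hmeas i) (by fun_prop)]
    simp only [real_inner_smul_left, real_inner_comm t (v i)]
    refine Eq.trans ?_ (h2.trans ?_)
    · refine integral_congr_ae (Eventually.of_forall fun ω => ?_)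
      simp [mul_comm]
    · simp [neg_div]
  simp only [h1]
  rw [← Complex.exp_sum, ← Finset.sum_div, Finset.sum_neg_distrib]
  push_cast
  rfl

/-- The map x ↦ e^{ix} is 1-Lipschitz, and the L¹ norm is at most the L² norm for a probability.
Characteristic functions of partial sums therefore pass to the L² limit. -/
theorem norm_charFun_sub_le (X Y : Lp E 2 (gaussWeights ι)) (t : E) :
    ‖charFun ((gaussWeights ι).map X) t - charFun ((gaussWeights ι).map Y) t‖ ≤ ‖X - Y‖ * ‖t‖ := by
  have hX : AEMeasurable X (gaussWeights ι) := (Lp.aestronglyMeasurable X).aemeasurable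
  have hY : AEMeasurable Y (gaussWeights ι) := (Lp.aestronglyMeasurable Y).aemeasurable
  have hint : ∀ {Z : (ι → ℝ) → E}, AEMeasurable Z (gaussWeights ι) →
      Integrable (fun ω => Complex.exp (inner ℝ (Z ω) t * Complex.I)) (gaussWeights ι) :=
    fun {Z} hZ => by
    refine Integrable.of_bound (C := 1) (AEMeasurable.aestronglyMeasurable (by fun_prop)) ?_
    exact Eventually.of_forall fun ω => (Complex.norm_exp_ofReal_mul_I _).le
  rw [charFun_apply, charFun_apply, integral_map hX (by fun_prop), integral_map hY (by fun_prop),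
    ← integral_sub (hint hX) (hint hY)]
  have hL1 : Integrable (fun ω => ‖(X - Y : Lp E 2 (gaussWeights ι)) ω‖ * ‖t‖) (gaussWeights ι) :=
    (((Lp.memLp (X - Y)).integrable one_le_two).norm).mul_const _
  refine (norm_integral_le_integral_norm _).trans ?_
  have hle : ∫ ω, ‖Complex.exp (inner ℝ (X ω) t * Complex.I) -
      Complex.exp (inner ℝ (Y ω) t * Complex.I)‖ ∂(gaussWeights ι) ≤
      ∫ ω, ‖(X - Y : Lp E 2 (gaussWeights ι)) ω‖ * ‖t‖ ∂(gaussWeights ι) := by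
    refine integral_mono_ae ((hint hX).sub (hint hY)).norm hL1 ?_
    filter_upwards [Lp.coeFn_sub X Y] with ω hω
    rw [hω, Pi.sub_apply]
    have h1 : Complex.exp (inner ℝ (X ω) t * Complex.I) - Complex.exp (inner ℝ (Y ω) t * Complex.I)
        = Complex.exp (inner ℝ (Y ω) t * Complex.I) *
          (Complex.exp (Complex.I * ((inner ℝ (X ω - Y ω) t : ℝ) : ℂ)) - 1) := by
      rw [mul_sub, mul_one, ← Complex.exp_add, inner_sub_left]
      congr 2
      push_cast
      ring
    rw [h1, norm_mul, Complex.norm_exp_ofReal_mul_I, one_mul]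
    exact Real.norm_exp_I_mul_ofReal_sub_one_le.trans (norm_inner_le_norm _ _)
  refine hle.trans ?_
  rw [integral_mul_const]
  refine mul_le_mul_of_nonneg_right ?_ (norm_nonneg _)
  rw [Lp.norm_def, integral_norm_eq_lintegral_enorm (Lp.aestronglyMeasurable _),
    ← eLpNorm_one_eq_lintegral_enorm]
  exact ENNReal.toReal_mono (Lp.eLpNorm_ne_top _)
    (eLpNorm_le_eLpNorm_of_exponent_le one_le_two (Lp.aestronglyMeasurable _))

theorem coeFn_sum_gaussTerm (v : ι → E) (s : Finset ι) :
    (∑ i ∈ s, gaussTerm i (v i) : Lp E 2 (gaussWeights ι)) =ᵐ[gaussWeights ι]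
      ∑ i ∈ s, fun ω : ι → ℝ => ω i • v i := by
  classical
  induction s using Finset.induction_on with
  | empty => simpa using Lp.coeFn_zero E 2 (gaussWeights ι)
  | insert i s hi ih =>
    rw [Finset.sum_insert hi, Finset.sum_insert hi]
    refine (Lp.coeFn_add _ _).trans ?_
    exact (memLp_gaussTerm i (v i)).coeFn_toLp.add ih

/-- The law of `∑ ξ_i v_i`. -/
noncomputable def gaussLaw (v : ι → E) : Measure E := (gaussWeights ι).map (gaussSeries v)

instance (v : ι → E) : IsProbabilityMeasure (gaussLaw v) :=
  Measure.isProbabilityMeasure_map (Lp.aestronglyMeasurable _).aemeasurable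

theorem charFun_gaussLaw {v : ι → E} (hv : Summable fun i => ‖v i‖ ^ 2) (t : E) {q : ℝ}
    (hq : HasSum (fun i => inner ℝ t (v i) ^ 2) q) :
    charFun (gaussLaw v) t = Complex.exp (-(q : ℂ) / 2) := by
  have h1 : Tendsto (fun s : Finset ι => charFun ((gaussWeights ι).map
      (∑ i ∈ s, gaussTerm i (v i) : Lp E 2 (gaussWeights ι))) t) atTop
      (𝓝 (charFun (gaussLaw v) t)) := by
    rw [tendsto_iff_norm_sub_tendsto_zero]
    have h2 : Tendsto (fun s : Finset ι => ‖∑ i ∈ s, gaussTerm i (v i) - gaussSeries v‖ * ‖t‖) atTop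
        (𝓝 0) := by
      have h3 : Tendsto (fun s : Finset ι => ∑ i ∈ s, gaussTerm i (v i)) atTop (𝓝 (gaussSeries v)) :=
        (summable_gaussTerm hv).hasSum
      simpa using (tendsto_iff_norm_sub_tendsto_zero.1 h3).mul_const ‖t‖
    exact squeeze_zero (fun s => norm_nonneg _) (fun s => norm_charFun_sub_le _ _ t) h2
  simp only [Measure.map_congr (coeFn_sum_gaussTerm v _), charFun_sum_gaussTerm] at h1
  refine tendsto_nhds_unique h1 ?_
  have h4 : Tendsto (fun s : Finset ι => ∑ i ∈ s, inner ℝ t (v i) ^ 2) atTop (𝓝 q) := hq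
  have h5 : Continuous fun x : ℝ => Complex.exp (-(x : ℂ) / 2) := by fun_prop
  exact (h5.tendsto q).comp h4

/-- Gaussianity, mean and covariance are all read off the characteristic function exp(-⟨t, S t⟩/2).
-/
theorem isCenteredGaussian_gaussLaw {v : ι → E} (hv : Summable fun i => ‖v i‖ ^ 2) {S : E →L[ℝ] E}
    (hS : ∀ t u, HasSum (fun i => inner ℝ t (v i) * inner ℝ u (v i)) (inner ℝ t (S u))) :
    IsCenteredGaussian (gaussLaw v) S := by
  let F : E →L[ℝ] E →L[ℝ] ℝ := LinearMap.mkContinuous₂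
    (LinearMap.mk₂ ℝ (fun t u => inner ℝ t (S u)) (fun x y z => inner_add_left _ _ _)
      (fun c x y => real_inner_smul_left _ _ _) (fun x y z => by rw [map_add, inner_add_right])
      (fun c x y => by rw [map_smul, inner_smul_right]; rfl)) ‖S‖ fun t u => by
      refine (norm_inner_le_norm t (S u)).trans ?_
      nlinarith [S.le_opNorm u, norm_nonneg t]
  have hF : ∀ t u, F t u = inner ℝ t (S u) := fun t u => rfl
  have hpos : F.toBilinForm.IsPosSemidef := by
    refine ⟨⟨fun t u => ?_⟩, ⟨fun t => ?_⟩⟩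
    · change inner ℝ t (S u) = inner ℝ u (S t)
      refine (hS t u).unique ?_
      simpa only [mul_comm] using hS u t
    · change 0 ≤ inner ℝ t (S t)
      exact (hS t t).nonneg fun i => mul_self_nonneg _
  have hchar : ∀ t, charFun (gaussLaw v) t =
      Complex.exp (((inner ℝ t (0 : E) : ℝ) : ℂ) * Complex.I - ((F t t : ℝ) : ℂ) / 2) := fun t => by
    rw [charFun_gaussLaw hv t (q := inner ℝ t (S t)) (by simpa only [sq] using hS t t), hF]
    simp [neg_div]
  obtain ⟨h1, h2⟩ := gaussian_charFun_congr 0 F hpos hchar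
  exact ⟨isGaussian_iff_gaussian_charFun.2 ⟨0, F, hpos, hchar⟩, h1.symm, fun u w => by rw [← h2, hF]⟩

/-- Using the same weights ξ_i for both series couples the laws; the cost is the squared L² norm of
∑ ξ_i (v_i - w_i). -/
theorem W2_gaussLaw_le {v w : ι → E} (hv : Summable fun i => ‖v i‖ ^ 2)
    (hw : Summable fun i => ‖w i‖ ^ 2) :
    W2 (gaussLaw v) (gaussLaw w) ≤ (∑' i, ENNReal.ofReal (‖v i - w i‖ ^ 2)) ^ (1 / 2 : ℝ) := by
  have hX : AEMeasurable (gaussSeries v) (gaussWeights ι) :=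
    (Lp.aestronglyMeasurable _).aemeasurable
  have hY : AEMeasurable (gaussSeries w) (gaussWeights ι) :=
    (Lp.aestronglyMeasurable _).aemeasurable
  set γ : Measure (E × E) := (gaussWeights ι).map fun ω => (gaussSeries v ω, gaussSeries w ω) with hγ
  have hmem : γ ∈ couplings (gaussLaw v) (gaussLaw w) := by
    constructor
    · rw [hγ, AEMeasurable.map_map_of_aemeasurable (by fun_prop) (hX.prodMk hY)]; rfl
    · rw [hγ, AEMeasurable.map_map_of_aemeasurable (by fun_prop) (hX.prodMk hY)]; rfl
  refine ENNReal.rpow_le_rpow ((iInf₂_le γ hmem).trans (le_of_eq ?_)) (by norm_num)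
  have hvw : Summable fun i => ‖v i - w i‖ ^ 2 := by
    have hle : ∀ i, ‖v i - w i‖ ^ 2 ≤ 2 * ‖v i‖ ^ 2 + 2 * ‖w i‖ ^ 2 := fun i => by
      have h1 := norm_sub_le (v i) (w i)
      nlinarith [norm_nonneg (v i - w i), sq_nonneg (‖v i‖ - ‖w i‖)]
    exact Summable.of_nonneg_of_le (fun i => sq_nonneg _) hle ((hv.mul_left 2).add (hw.mul_left 2))
  rw [quadCost, hγ, lintegral_map' (by fun_prop) (hX.prodMk hY),
    ← ENNReal.ofReal_tsum_of_nonneg (fun i => sq_nonneg _) hvw]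
  have h1 := norm_gaussSeries_sq (v := v - w) (by simpa using hvw)
  simp only [Pi.sub_apply] at h1
  rw [← h1, ← gaussSeries_sub hv hw, ← real_inner_self_eq_norm_sq, L2.inner_def,
    ofReal_integral_eq_lintegral_ofReal]
  · refine lintegral_congr_ae ?_
    filter_upwards [Lp.coeFn_sub (gaussSeries v) (gaussSeries w)] with ω hω
    rw [hω, real_inner_self_eq_norm_sq]; rfl
  · exact L2.integrable_inner _ _
  · exact Eventually.of_forall fun ω => real_inner_self_nonneg

end GaussianSeries

/-! ### Block covariances and Wasserstein convergence -/

section BlockGaussian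

variable {H : Type*} [NormedAddCommGroup H] [InnerProductSpace ℝ H] [CompleteSpace H]

/-- A family of vectors of `H × H` that represents the block covariance with cross term `G R M*`,
when `I - R* R` is diagonal in the basis `f` with eigenvalues `(s i)²`. -/
noncomputable def blockFamily (G M R : H →L[ℝ] H) {ι : Type*} (f : HilbertBasis ι ℝ H) (s : ι → ℝ) :
    basisIndex H ⊕ ι → WithLp 2 (H × H) :=
  Sum.elim (fun b => WithLp.toLp 2 (G (basis H b), M ((R†) (basis H b))))
    fun i => WithLp.toLp 2 (0, s i • M (f i))

variable {A B G M R : H →L[ℝ] H} {ι : Type*} {f : HilbertBasis ι ℝ H} {s : ι → ℝ}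

theorem summable_blockFamily (hG : IsHilbertSchmidt G) (hM : IsHilbertSchmidt M)
    (hs : ∀ i, |s i| ≤ 1) : Summable fun k => ‖blockFamily G M R f s k‖ ^ 2 := by
  refine Summable.sum _ ?_ ?_
  · refine ((hG.summable (basis H)).add ((hM.comp_right (R†)).summable (basis H))).congr fun i => ?_
    simp [blockFamily, WithLp.prod_norm_sq_eq_of_L2]
  · refine Summable.of_nonneg_of_le (fun i => sq_nonneg _) (fun i => ?_) (hM.summable f)
    have h1 : ‖blockFamily G M R f s (Sum.inr i)‖ ^ 2 = |s i| ^ 2 * ‖M (f i)‖ ^ 2 := by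
      simp [blockFamily, norm_smul, mul_pow]
    change ‖blockFamily G M R f s (Sum.inr i)‖ ^ 2 ≤ _
    rw [h1]
    exact mul_le_of_le_one_left (sq_nonneg _) (pow_le_one₀ (abs_nonneg _) (hs i))

/-- The column (G, M R*) reproduces A and the cross term, but only M R*R M* in the last block; the
column (0, M(I - R*R)^{1/2}) supplies the rest of B. The identity is checked on inner products by
Parseval in each index set. -/
theorem hasSum_blockFamily (hG : G ∘L G† = A) (hM : M ∘L M† = B)
    (hR : ∀ i x, inner ℝ (R (f i)) (R x) = (1 - s i ^ 2) * inner ℝ (f i) x)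
    (t u : WithLp 2 (H × H)) :
    HasSum (fun k => inner ℝ t (blockFamily G M R f s k) * inner ℝ u (blockFamily G M R f s k))
      (inner ℝ t (blockCov A (G ∘L R ∘L M†) B u)) := by
  have h1 := (basis H).hasSum_inner_mul_inner ((G†) t.fst + R ((M†) t.snd))
    ((G†) u.fst + R ((M†) u.snd))
  have h2 := (f.hasSum_inner_mul_inner ((M†) t.snd) ((M†) u.snd)).sub
    (hasSum_inner_of_orthogonal f hR ((M†) t.snd) ((M†) u.snd))
  have h3 : inner ℝ t (blockCov A (G ∘L R ∘L M†) B u) =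
      inner ℝ ((G†) t.fst + R ((M†) t.snd)) ((G†) u.fst + R ((M†) u.snd)) +
        (inner ℝ ((M†) t.snd) ((M†) u.snd) - inner ℝ (R ((M†) t.snd)) (R ((M†) u.snd))) := by
    rw [← hG, ← hM, WithLp.prod_inner_apply]
    simp only [blockCov, ContinuousLinearMap.comp_apply, ContinuousLinearMap.adjoint_comp,
      ContinuousLinearMap.adjoint_adjoint]
    change inner ℝ t.fst (G ((G†) u.fst) + G (R ((M†) u.snd))) +
      inner ℝ t.snd (M ((R†) ((G†) u.fst)) + M ((M†) u.snd)) = _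
    simp only [inner_add_left, inner_add_right, ContinuousLinearMap.adjoint_inner_left]
    rw [← ContinuousLinearMap.adjoint_inner_left M, ← ContinuousLinearMap.adjoint_inner_left (R†),
      ContinuousLinearMap.adjoint_adjoint]
    ring
  rw [h3]
  refine HasSum.sum ?_ ?_
  · rw [show (fun k => inner ℝ t (blockFamily G M R f s k) * inner ℝ u (blockFamily G M R f s k)) ∘
      Sum.inl = fun b => inner ℝ ((G†) t.fst + R ((M†) t.snd)) (basis H b) *
        inner ℝ (basis H b) ((G†) u.fst + R ((M†) u.snd)) from funext fun b => ?_]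
    · exact h1
    · rw [← real_inner_comm (basis H b)]
      simp only [Function.comp_apply, blockFamily, Sum.elim_inl, WithLp.prod_inner_apply,
        inner_add_left, ContinuousLinearMap.adjoint_inner_left]
      simp only [← ContinuousLinearMap.adjoint_inner_left M,
        ContinuousLinearMap.adjoint_inner_right R]
      rfl
  · rw [show (fun k => inner ℝ t (blockFamily G M R f s k) * inner ℝ u (blockFamily G M R f s k)) ∘
      Sum.inr = fun i => inner ℝ ((M†) t.snd) (f i) * inner ℝ (f i) ((M†) u.snd) -
        (1 - s i ^ 2) * (inner ℝ (f i) ((M†) t.snd) * inner ℝ (f i) ((M†) u.snd)) from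
      funext fun i => ?_]
    · exact h2
    · rw [← real_inner_comm ((M†) t.snd)]
      simp only [Function.comp_apply, blockFamily, Sum.elim_inr, WithLp.prod_inner_apply,
        inner_zero_right, zero_add, inner_smul_right, ContinuousLinearMap.adjoint_inner_right,
        real_inner_comm (M (f i))]
      ring_nf
      rfl

variable {l : ι → ℝ} {ε : ℝ} [MeasurableSpace H] [BorelSpace H] [SecondCountableTopology H]

/-- The Gaussian measure with covariance blocks `G G*`, `G R M*`, `M M*`. -/
noncomputable def blockLaw (G M R : H →L[ℝ] H) {ι : Type*} (f : HilbertBasis ι ℝ H) (s : ι → ℝ) :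
    Measure (WithLp 2 (H × H)) := gaussLaw (blockFamily G M R f s)

theorem isCenteredGaussian_blockLaw (hG : IsGreen A G) (hM : IsGreen B M) (hs : ∀ i, |s i| ≤ 1)
    (hR : ∀ i x, inner ℝ (R (f i)) (R x) = (1 - s i ^ 2) * inner ℝ (f i) x) :
    IsCenteredGaussian (blockLaw G M R f s) (blockCov A (G ∘L R ∘L M†) B) := by
  have h1 := summable_blockFamily (f := f) (R := R) hG.1 hM.1 hs
  have h2 := hasSum_blockFamily hG.2 hM.2 hR
  exact isCenteredGaussian_gaussLaw h1 h2

/-- The component G of the family does not involve R and cancels. The remaining differences are M(R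
- R')* e and (s_i - s'_i) M f_i. -/
theorem W2_blockLaw_le (hG : IsHilbertSchmidt G) (hM : IsHilbertSchmidt M) {R' : H →L[ℝ] H}
    {s' : ι → ℝ} (hs : ∀ i, |s i| ≤ 1) (hs' : ∀ i, |s' i| ≤ 1) :
    W2 (blockLaw G M R f s) (blockLaw G M R' f s') ≤
      (hsSq ((R - R') ∘L M†) + ∑' i, ENNReal.ofReal (‖(s i - s' i) • M (f i)‖ ^ 2)) ^ (1 / 2 : ℝ) := by
  have h1 := W2_gaussLaw_le (summable_blockFamily (f := f) (R := R) hG hM hs)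
    (summable_blockFamily (f := f) (R := R') hG hM hs')
  refine h1.trans (le_of_eq ?_)
  congr 1
  rw [ENNReal.summable.tsum_sum ENNReal.summable, ← hsSq_adjoint]
  congr 1
  · refine tsum_congr fun b => ?_
    rw [WithLp.prod_norm_sq_eq_of_L2]
    simp [blockFamily, ContinuousLinearMap.adjoint_comp]
  · refine tsum_congr fun i => ?_
    rw [WithLp.prod_norm_sq_eq_of_L2]
    simp [blockFamily, sub_smul]

/-- The singular values of `(I - R_ε* R_ε)^{1/2}`. -/
noncomputable def defect (l : ι → ℝ) (ε : ℝ) (i : ι) : ℝ := √(ε * shrink ε (l i))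

/-- The singular values of `(I - W* W)^{1/2}` for the limit correlation `W`. -/
noncomputable def limitDefect (l : ι → ℝ) (i : ι) : ℝ := if l i = 0 then 1 else 0

theorem defect_sq (hl : ∀ i, 0 ≤ l i) (hε : 0 < ε) (i : ι) :
    1 - defect l ε i ^ 2 = l i * shrink ε (l i) ^ 2 := by
  rw [defect, Real.sq_sqrt (mul_pos hε (shrink_pos hε)).le, shrink_eq hε (hl i)]

theorem defect_mem (hl : ∀ i, 0 ≤ l i) (hε : 0 < ε) (i : ι) :
    0 ≤ defect l ε i ∧ defect l ε i ≤ 1 := by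
  refine ⟨Real.sqrt_nonneg _, Real.sqrt_le_one.2 ?_⟩
  have := shrink_eq hε (hl i)
  nlinarith [mul_nonneg (hl i) (sq_nonneg (shrink ε (l i)))]

theorem abs_limitDefect_le (i : ι) : |limitDefect l i| ≤ 1 := by
  unfold limitDefect; split_ifs <;> simp

theorem abs_defect_sub_le (hl : ∀ i, 0 ≤ l i) (hε : 0 < ε) (i : ι) :
    |defect l ε i - limitDefect l i| ≤ 1 := by
  obtain ⟨h1, h2⟩ := defect_mem hl hε i
  unfold limitDefect
  rw [abs_le]
  split_ifs <;> constructor <;> linarith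

theorem tendsto_defect_sub (hl : ∀ i, 0 ≤ l i) (i : ι) :
    Tendsto (fun ε => defect l ε i - limitDefect l i) (𝓝[>] 0) (𝓝 0) := by
  -- The square of the defect is 1 - l c²: constantly 1 when l = 0, and 1 - (√l c)² → 0 when l > 0.
  have h1 : Tendsto (fun ε => 1 - l i * shrink ε (l i) ^ 2) (𝓝[>] 0)
      (𝓝 (limitDefect l i ^ 2)) := by
    unfold limitDefect
    split_ifs with h
    · simp [h]
    · have := ((tendsto_sqrt_mul_shrink ((hl i).lt_of_ne' h)).pow 2).const_sub 1
      simpa [mul_pow, Real.sq_sqrt (hl i)] using this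
  have h2 := h1.sqrt
  rw [Real.sqrt_sq (by unfold limitDefect; split_ifs <;> simp)] at h2
  have h3 : Tendsto (fun ε => defect l ε i) (𝓝[>] 0) (𝓝 (limitDefect l i)) := by
    refine h2.congr' ?_
    filter_upwards [self_mem_nhdsWithin] with ε hε
    rw [← defect_sq hl hε, sub_sub_cancel, Real.sqrt_sq (defect_mem hl hε i).1]
  simpa using h3.sub_const (limitDefect l i)

theorem IsShrunk.isCenteredGaussian (hR : IsShrunk G M f l ε R) (h : IsSingularBasis G M f l)
    (hε : 0 < ε) (hG : IsGreen A G) (hM : IsGreen B M) :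
    IsCenteredGaussian (blockLaw G M R f (defect l ε)) (blockCov A (G ∘L R ∘L M†) B) := by
  refine isCenteredGaussian_blockLaw hG hM (fun i => ?_) fun i x => ?_
  · rw [abs_of_nonneg (defect_mem h.nonneg hε i).1]
    exact (defect_mem h.nonneg hε i).2
  · rw [defect_sq h.nonneg hε, hR.inner_apply h]

theorem IsLimitCorrelation.isCenteredGaussian {W : H →L[ℝ] H} (hW : IsLimitCorrelation G M f l W)
    (hG : IsGreen A G) (hM : IsGreen B M) :
    IsCenteredGaussian (blockLaw G M W f (limitDefect l)) (blockCov A (G ∘L W ∘L M†) B) := by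
  refine isCenteredGaussian_blockLaw hG hM abs_limitDefect_le fun i x => ?_
  rw [hW.inner_apply, limitDefect]
  split_ifs <;> simp

theorem tendsto_W2 {W : H →L[ℝ] H} (h : IsSingularBasis G M f l)
    (hW : IsLimitCorrelation G M f l W) (hG : IsHilbertSchmidt G) (hM : IsHilbertSchmidt M)
    {R : ℝ → H →L[ℝ] H} (hR : ∀ ε, 0 < ε → IsShrunk G M f l ε (R ε)) :
    Tendsto (fun ε => W2 (blockLaw G M (R ε) f (defect l ε)) (blockLaw G M W f (limitDefect l)))
      (𝓝[>] 0) (𝓝 0) := by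
  have h1 := (tendsto_tsum_mul_sq hM f (fun ε hε => abs_deviation_le h.nonneg hε)
    (tendsto_deviation h.nonneg)).add (tendsto_tsum_mul_sq hM f
      (fun ε hε => abs_defect_sub_le h.nonneg hε) (tendsto_defect_sub h.nonneg))
  have h2 := h1.ennrpow_const (1 / 2)
  rw [add_zero, ENNReal.zero_rpow_of_pos (by norm_num)] at h2
  refine tendsto_of_tendsto_of_tendsto_of_le_of_le' tendsto_const_nhds h2
    (Eventually.of_forall fun _ => zero_le) ?_
  filter_upwards [self_mem_nhdsWithin] with ε hε
  refine (W2_blockLaw_le hG hM (fun i => ?_) abs_limitDefect_le).trans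
    (ENNReal.rpow_le_rpow ?_ (by norm_num))
  · rw [abs_of_nonneg (defect_mem h.nonneg hε i).1]
    exact (defect_mem h.nonneg hε i).2
  · gcongr
    exact hsSq_sub_comp_adjoint_le h hW hε (hR ε hε)

end BlockGaussian

/-! ### Centered Gaussian measures -/

section CenteredGaussian

variable {E : Type*} [NormedAddCommGroup E] [InnerProductSpace ℝ E] [CompleteSpace E]
  [MeasurableSpace E] [BorelSpace E] [SecondCountableTopology E]

theorem IsCenteredGaussian.eq {μ ν : Measure E} {S : E →L[ℝ] E} (hμ : IsCenteredGaussian μ S)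
    (hν : IsCenteredGaussian ν S) : μ = ν := by
  have := hμ.1
  have := hν.1
  refine IsGaussian.ext (hμ.2.1.trans hν.2.1.symm) ?_
  ext u v
  rw [hμ.2.2, hν.2.2]

theorem IsCenteredGaussian.map {F : Type*} [NormedAddCommGroup F] [InnerProductSpace ℝ F]
    [CompleteSpace F] [MeasurableSpace F] [BorelSpace F] [SecondCountableTopology F]
    {μ : Measure E} {S : E →L[ℝ] E} (hμ : IsCenteredGaussian μ S) (L : E →L[ℝ] F) :
    IsCenteredGaussian (μ.map L) (L ∘L S ∘L L†) := by
  have := hμ.1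
  refine ⟨isGaussian_map L, ?_, fun u v => ?_⟩
  · rw [integral_map (by fun_prop) (by fun_prop)]
    refine (L.integral_comp_comm IsGaussian.integrable_id).trans ?_
    have h := hμ.2.1
    simp only [id]
    rw [h, map_zero]
  · rw [covarianceBilin_map IsGaussian.memLp_two_id, hμ.2.2,
      ContinuousLinearMap.adjoint_inner_left]
    rfl

theorem IsCenteredGaussian.memLp {μ : Measure E} {S : E →L[ℝ] E} (hμ : IsCenteredGaussian μ S) :
    MemLp id 2 μ := by
  have := hμ.1
  exact IsGaussian.memLp_two_id

theorem IsCenteredGaussian.integral_inner_mul {μ : Measure E} {S : E →L[ℝ] E}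
    (hμ : IsCenteredGaussian μ S) (u v : E) :
    ∫ z, inner ℝ u z * inner ℝ v z ∂μ = inner ℝ u (S v) := by
  have := hμ.1
  have h := hμ.2.1
  rw [← hμ.2.2, covarianceBilin_apply hμ.memLp]
  simp only [id, h, sub_zero]

end CenteredGaussian

/-! ### Correlation operators of couplings and the trace bound -/

section Coupling

variable {H : Type*} [NormedAddCommGroup H] [InnerProductSpace ℝ H] [CompleteSpace H]

/-- Distinct basis vectors are at distance √2, so balls of radius 1/2 around them are disjoint open
sets. Countability is needed to exchange an integral with a sum over the basis. -/
theorem countable_basisIndex [SecondCountableTopology H] : Countable (basisIndex H) := by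
  have hd : (Set.univ : Set (basisIndex H)).PairwiseDisjoint
      fun i => Metric.ball (basis H i) (1 / 2) := fun i _ j _ hij => by
    refine Metric.ball_disjoint_ball ?_
    have h1 : ‖basis H i - basis H j‖ ^ 2 = 2 := by
      rw [norm_sub_sq_real, inner_basis_of_ne _ hij, (basis H).orthonormal.1,
        (basis H).orthonormal.1]
      norm_num
    rw [dist_eq_norm]
    nlinarith [norm_nonneg (basis H i - basis H j)]
  exact Set.countable_univ_iff.1 <| hd.countable_of_isOpen (fun i _ => Metric.isOpen_ball)
    fun i _ => ⟨_, Metric.mem_ball_self (by norm_num)⟩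

variable {Ω : Type*} [MeasurableSpace Ω] {γ : Measure Ω} {X Y : Ω → H} {a b : H →L[ℝ] H}

theorem exists_innerLp (hX : MemLp X 2 γ) (ha : ∀ u, ∫ ω, inner ℝ u (X ω) ^ 2 ∂γ = ‖a u‖ ^ 2) :
    ∃ Φ : H →L[ℝ] Lp ℝ 2 γ, (∀ u, Φ u =ᵐ[γ] fun ω => inner ℝ u (X ω)) ∧ ∀ u, ‖Φ u‖ = ‖a u‖ := by
  let F : H →ₗ[ℝ] Lp ℝ 2 γ :=
    { toFun := fun u => (hX.const_inner (𝕜 := ℝ) u).toLp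
      map_add' := fun u v => by
        rw [← MemLp.toLp_add]
        congr 1
        ext ω
        simp [inner_add_left]
      map_smul' := fun c u => by
        rw [RingHom.id_apply, ← MemLp.toLp_const_smul]
        congr 1
        ext ω
        simp [real_inner_smul_left] }
  have hF : ∀ u, F u =ᵐ[γ] fun ω => inner ℝ u (X ω) := fun u =>
    (hX.const_inner (𝕜 := ℝ) u).coeFn_toLp
  have hn : ∀ u, ‖F u‖ = ‖a u‖ := fun u => by
    refine (pow_left_inj₀ (norm_nonneg _) (norm_nonneg _) two_ne_zero).1 ?_
    rw [← real_inner_self_eq_norm_sq, L2.inner_def, ← ha]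
    refine integral_congr_ae ?_
    filter_upwards [hF u] with ω hω
    rw [hω, real_inner_self_eq_norm_sq, Real.norm_eq_abs, sq_abs]
  exact ⟨F.mkContinuous ‖a‖ fun u => (hn u).trans_le (a.le_opNorm u), hF, hn⟩

/-- The variables ⟨u, X⟩ have L² norm ‖a u‖, so they equal U(a u) for a contraction U into L²;
likewise ⟨v, Y⟩ = V(b v). Then K = U*V. -/
theorem exists_correlation (hX : MemLp X 2 γ) (hY : MemLp Y 2 γ)
    (ha : ∀ u, ∫ ω, inner ℝ u (X ω) ^ 2 ∂γ = ‖a u‖ ^ 2)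
    (hb : ∀ u, ∫ ω, inner ℝ u (Y ω) ^ 2 ∂γ = ‖b u‖ ^ 2) :
    ∃ K : H →L[ℝ] H, (∀ z, ‖K z‖ ≤ ‖z‖) ∧
      ∀ u v, ∫ ω, inner ℝ u (X ω) * inner ℝ v (Y ω) ∂γ = inner ℝ (a u) (K (b v)) := by
  obtain ⟨Φ, hΦ, hΦn⟩ := exists_innerLp hX ha
  obtain ⟨Ψ, hΨ, hΨn⟩ := exists_innerLp hY hb
  obtain ⟨U, hU, -, hUn, -⟩ := exists_partialIsometry Φ a hΦn
  obtain ⟨V, hV, -, hVn, -⟩ := exists_partialIsometry Ψ b hΨn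
  have hU1 : ‖(U†)‖ ≤ 1 := by
    rw [LinearIsometryEquiv.norm_map]
    exact U.opNorm_le_bound zero_le_one fun z => by simpa using hUn z
  refine ⟨U† ∘L V, fun z => ?_, fun u v => ?_⟩
  · refine ((U†).le_opNorm (V z)).trans ?_
    refine (mul_le_of_le_one_left (norm_nonneg _) hU1).trans (hVn z)
  · rw [ContinuousLinearMap.comp_apply, ContinuousLinearMap.adjoint_inner_right, hU, hV, L2.inner_def]
    refine integral_congr_ae ?_
    filter_upwards [hΦ u, hΨ v] with ω h1 h2
    rw [h1, h2]
    simp [mul_comm]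

theorem integrable_inner_mul (hX : MemLp X 2 γ) (hY : MemLp Y 2 γ) (u v : H) :
    Integrable (fun ω => inner ℝ u (X ω) * inner ℝ v (Y ω)) γ :=
  (hX.const_inner (𝕜 := ℝ) u).integrable_mul (hY.const_inner (𝕜 := ℝ) v)

theorem integral_inner_sub_sq (hX : MemLp X 2 γ) (hY : MemLp Y 2 γ) (u : H) :
    ∫ ω, inner ℝ u (X ω - Y ω) ^ 2 ∂γ = ∫ ω, inner ℝ u (X ω) ^ 2 ∂γ +
      ∫ ω, inner ℝ u (Y ω) ^ 2 ∂γ - 2 * ∫ ω, inner ℝ u (X ω) * inner ℝ u (Y ω) ∂γ := by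
  have h1 := integrable_inner_mul hX hX u u
  have h2 := integrable_inner_mul hY hY u u
  have h3 := integrable_inner_mul hX hY u u
  simp only [← sq] at h1 h2
  rw [← integral_const_mul, ← integral_add h1 h2]
  refine Eq.trans ?_ (integral_sub (h1.add h2) (h3.const_mul 2))
  refine integral_congr_ae (Eventually.of_forall fun ω => ?_)
  simp only [inner_sub_right]
  ring

/-- Parseval under the integral reduces the cost to second moments of the coordinates, which sum to
two Hilbert–Schmidt norms and a trace. -/
theorem lintegral_norm_sub_sq [SecondCountableTopology H] [MeasurableSpace H] [BorelSpace H]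
    (hX : MemLp X 2 γ) (hY : MemLp Y 2 γ) (haHS : IsHilbertSchmidt a) (hbHS : IsHilbertSchmidt b)
    (haa : a† = a)
    (ha : ∀ u, ∫ ω, inner ℝ u (X ω) ^ 2 ∂γ = ‖a u‖ ^ 2)
    (hb : ∀ u, ∫ ω, inner ℝ u (Y ω) ^ 2 ∂γ = ‖b u‖ ^ 2) {K : H →L[ℝ] H}
    (hK : ∀ u v, ∫ ω, inner ℝ u (X ω) * inner ℝ v (Y ω) ∂γ = inner ℝ (a u) (K (b v))) :
    ∫⁻ ω, ENNReal.ofReal (‖X ω - Y ω‖ ^ 2) ∂γ =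
      ENNReal.ofReal (∑' i, ‖a (basis H i)‖ ^ 2 + ∑' i, ‖b (basis H i)‖ ^ 2
        - 2 * trace (a ∘L K ∘L b)) := by
  have := countable_basisIndex (H := H)
  have hZ : MemLp (fun ω => X ω - Y ω) 2 γ := hX.sub hY
  have hsq : ∀ i, Integrable (fun ω => inner ℝ (basis H i) (X ω - Y ω) ^ 2) γ := fun i => by
    simpa only [sq] using integrable_inner_mul hZ hZ (basis H i) (basis H i)
  have hsum : HasSum (fun i => ∫ ω, inner ℝ (basis H i) (X ω - Y ω) ^ 2 ∂γ)
      (∑' i, ‖a (basis H i)‖ ^ 2 + ∑' i, ‖b (basis H i)‖ ^ 2 - 2 * trace (a ∘L K ∘L b)) := by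
    have h1 := hasSum_trace_comp (basis H) (S := K ∘L b) (T := a) (hbHS.comp_left K) haHS
    rw [trace_comp_comm (hbHS.comp_left K) haHS] at h1
    rw [show (fun i => ∫ ω, inner ℝ (basis H i) (X ω - Y ω) ^ 2 ∂γ) = fun i =>
      ‖a (basis H i)‖ ^ 2 + ‖b (basis H i)‖ ^ 2 - 2 * inner ℝ (basis H i) (a ((K ∘L b) (basis H i)))
      from funext fun i => by
        rw [integral_inner_sub_sq hX hY, ha, hb, hK, ← haa, ContinuousLinearMap.adjoint_inner_right, haa]
        rfl]
    exact ((haHS.summable (basis H)).hasSum.add (hbHS.summable (basis H)).hasSum).sub (h1.mul_left 2)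
  simp_rw [← tsum_ofReal_inner_sq (basis H)]
  rw [lintegral_tsum fun i => (hsq i).aemeasurable.ennreal_ofReal, ← hsum.tsum_eq,
    ENNReal.ofReal_tsum_of_nonneg (fun i => integral_nonneg fun ω => sq_nonneg _) hsum.summable]
  exact tsum_congr fun i => (ofReal_integral_eq_lintegral_ofReal (hsq i)
    (Eventually.of_forall fun ω => sq_nonneg _)).symm

/-- In an eigenbasis h of P^{1/2}, cyclicity gives ∑ ⟨h_j, K B^{1/2}A^{1/2} h_j⟩, whose terms are at
most ‖B^{1/2}A^{1/2} h_j‖ = ‖P^{1/2} h_j‖. For K = V each term is the eigenvalue itself. -/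
theorem trace_correlation_le {A B K : H →L[ℝ] H} (hA : IsCovariance A) (hB : IsCovariance B)
    (hK : ∀ z, ‖K z‖ ≤ ‖z‖) :
    trace (opSqrt A ∘L K ∘L opSqrt B) ≤ trace (canonicalC A B) := by
  obtain ⟨V, hV⟩ := exists_isPolar hA hB
  have ha := hA.sqrt_isHilbertSchmidt
  have hb := hB.sqrt_isHilbertSchmidt
  have hQ := isCovariance_sqrt_opP hA hB
  obtain ⟨ι, h, q, hq⟩ := exists_eigenbasis hQ.isCompactOperator.1 hQ.1.isSymmetric
  rw [hV.canonicalC_eq hA hB]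
  refine hasSum_le (fun j => ?_) (hasSum_trace_comp h ha (hb.comp_left K))
    (hasSum_trace_comp h ha (hb.comp_left V))
  simp only [ContinuousLinearMap.comp_apply, hV.apply]
  have hq0 : 0 ≤ q j := by
    have := hQ.1.inner_nonneg_right (h j)
    rwa [hq, inner_smul_right, inner_basis_self, mul_one] at this
  rw [hq, inner_smul_right, inner_basis_self, mul_one]
  refine (real_inner_le_norm _ _).trans ?_
  rw [h.orthonormal.1, one_mul]
  refine (hK _).trans ?_
  rw [← norm_sqrt_opP hA hB, hq, norm_smul, h.orthonormal.1, mul_one, Real.norm_of_nonneg hq0]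

end Coupling

/-! ### Optimality of the canonical coupling -/

section Optimality

variable {H : Type*} [NormedAddCommGroup H] [InnerProductSpace ℝ H] [CompleteSpace H]
  {A B C : H →L[ℝ] H}

theorem adjoint_fstL (u : H) : ((WithLp.fstL 2 ℝ H H)†) u = WithLp.toLp 2 (u, 0) := by
  refine ext_inner_left ℝ fun z => ?_
  rw [ContinuousLinearMap.adjoint_inner_right, WithLp.prod_inner_apply]
  simp

theorem adjoint_sndL (u : H) : ((WithLp.sndL 2 ℝ H H)†) u = WithLp.toLp 2 (0, u) := by
  refine ext_inner_left ℝ fun z => ?_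
  rw [ContinuousLinearMap.adjoint_inner_right, WithLp.prod_inner_apply]
  simp

theorem blockCov_toLp (x y : H) :
    blockCov A C B (WithLp.toLp 2 (x, y)) = WithLp.toLp 2 (A x + C y, (C†) x + B y) := rfl

variable [SecondCountableTopology H] [MeasurableSpace H] [BorelSpace H] {μ ν : Measure H}

theorem memLp_fst {γ : Measure (H × H)} (hμ : IsCenteredGaussian μ A) (hγ : γ.map Prod.fst = μ) :
    MemLp Prod.fst 2 γ := by
  have h := hμ.memLp
  rw [← hγ] at h
  exact h.comp_of_map measurable_fst.aemeasurable

theorem memLp_snd {γ : Measure (H × H)} (hν : IsCenteredGaussian ν B) (hγ : γ.map Prod.snd = ν) :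
    MemLp Prod.snd 2 γ := by
  have h := hν.memLp
  rw [← hγ] at h
  exact h.comp_of_map measurable_snd.aemeasurable

theorem integral_inner_fst_sq {γ : Measure (H × H)} (hA : IsCovariance A)
    (hμ : IsCenteredGaussian μ A) (hγ : γ.map Prod.fst = μ) (u : H) :
    ∫ p, inner ℝ u p.1 ^ 2 ∂γ = ‖opSqrt A u‖ ^ 2 := by
  have h := hμ.integral_inner_mul u u
  rw [← hγ, integral_map measurable_fst.aemeasurable (by fun_prop)] at h
  rw [norm_sq_of_sq hA.sqrt_isPositive hA.sqrt_comp_self, ← h]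
  simp only [sq]

theorem integral_inner_snd_sq {γ : Measure (H × H)} (hB : IsCovariance B)
    (hν : IsCenteredGaussian ν B) (hγ : γ.map Prod.snd = ν) (u : H) :
    ∫ p, inner ℝ u p.2 ^ 2 ∂γ = ‖opSqrt B u‖ ^ 2 := by
  have h := hν.integral_inner_mul u u
  rw [← hγ, integral_map measurable_snd.aemeasurable (by fun_prop)] at h
  rw [norm_sq_of_sq hB.sqrt_isPositive hB.sqrt_comp_self, ← h]
  simp only [sq]

/-- The quadratic cost of a coupling of two centered Gaussian measures. -/
theorem exists_quadCost_eq (hA : IsCovariance A) (hB : IsCovariance B)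
    (hμ : IsCenteredGaussian μ A) (hν : IsCenteredGaussian ν B) {γ : Measure (H × H)}
    (hγ : γ ∈ couplings μ ν) :
    ∃ K : H →L[ℝ] H, (∀ z, ‖K z‖ ≤ ‖z‖) ∧
      (∀ u v, ∫ p, inner ℝ u p.1 * inner ℝ v p.2 ∂γ = inner ℝ (opSqrt A u) (K (opSqrt B v))) ∧
      quadCost γ = ENNReal.ofReal (∑' i, ‖opSqrt A (basis H i)‖ ^ 2 +
        ∑' i, ‖opSqrt B (basis H i)‖ ^ 2 - 2 * trace (opSqrt A ∘L K ∘L opSqrt B)) := by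
  have hX := memLp_fst hμ hγ.1
  have hY := memLp_snd hν hγ.2
  have ha := integral_inner_fst_sq hA hμ hγ.1
  have hb := integral_inner_snd_sq hB hν hγ.2
  obtain ⟨K, hK, hKc⟩ := exists_correlation hX hY ha hb
  exact ⟨K, hK, hKc, lintegral_norm_sub_sq hX hY hA.sqrt_isHilbertSchmidt hB.sqrt_isHilbertSchmidt
    (IsPositive.adjoint_eq' hA.sqrt_isPositive) ha hb hKc⟩

theorem IsCenteredGaussian.map_ofLp_mem_couplings {π : Measure (WithLp 2 (H × H))}
    (hπ : IsCenteredGaussian π (blockCov A C B)) (hμ : IsCenteredGaussian μ A)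
    (hν : IsCenteredGaussian ν B) : π.map WithLp.ofLp ∈ couplings μ ν := by
  have hm : Measurable (WithLp.ofLp : WithLp 2 (H × H) → H × H) :=
    (WithLp.prodContinuousLinearEquiv 2 ℝ H H).continuous.measurable
  constructor
  · rw [Measure.map_map measurable_fst hm]
    have h := hπ.map (WithLp.fstL 2 ℝ H H)
    have he : WithLp.fstL 2 ℝ H H ∘L blockCov A C B ∘L ((WithLp.fstL 2 ℝ H H)†) = A := by
      ext x
      simp [adjoint_fstL, blockCov_toLp]
    rw [he] at h
    exact h.eq hμ
  · rw [Measure.map_map measurable_snd hm]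
    have h := hπ.map (WithLp.sndL 2 ℝ H H)
    have he : WithLp.sndL 2 ℝ H H ∘L blockCov A C B ∘L ((WithLp.sndL 2 ℝ H H)†) = B := by
      ext x
      simp [adjoint_sndL, blockCov_toLp]
    rw [he] at h
    exact h.eq hν

theorem IsCenteredGaussian.integral_map_ofLp {π : Measure (WithLp 2 (H × H))}
    (hπ : IsCenteredGaussian π (blockCov A C B)) (u v : H) :
    ∫ p, inner ℝ u p.1 * inner ℝ v p.2 ∂(π.map WithLp.ofLp) = inner ℝ u (C v) := by
  have hm : Measurable (WithLp.ofLp : WithLp 2 (H × H) → H × H) :=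
    (WithLp.prodContinuousLinearEquiv 2 ℝ H H).continuous.measurable
  have h := hπ.integral_inner_mul (WithLp.toLp 2 (u, 0)) (WithLp.toLp 2 (0, v))
  rw [integral_map hm.aemeasurable (by fun_prop)]
  rw [blockCov_toLp] at h
  simpa [WithLp.prod_inner_apply] using h

theorem isOptimalCoupling_map_ofLp (hA : IsCovariance A) (hB : IsCovariance B)
    {π : Measure (WithLp 2 (H × H))} (hπ : IsCenteredGaussian π (blockCov A (canonicalC A B) B))
    (hμ : IsCenteredGaussian μ A) (hν : IsCenteredGaussian ν B) :
    IsOptimalCoupling μ ν (π.map WithLp.ofLp) := by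
  have hmem := hπ.map_ofLp_mem_couplings hμ hν
  refine ⟨hmem, fun γ hγ => ?_⟩
  obtain ⟨K, hK, -, hKq⟩ := exists_quadCost_eq hA hB hμ hν hγ
  obtain ⟨L, -, hLc, hLq⟩ := exists_quadCost_eq hA hB hμ hν hmem
  -- The contraction L attached to π₀ need not be V; only the cross-covariance A^{1/2} L B^{1/2}
  -- enters the cost.
  have hL : opSqrt A ∘L L ∘L opSqrt B = canonicalC A B := by
    ext v
    refine ext_inner_left ℝ fun u => ?_
    rw [← hπ.integral_map_ofLp, hLc]
    exact (IsPositive.inner_comm hA.sqrt_isPositive _ _).symm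
  change quadCost _ ≤ quadCost _
  rw [hKq, hLq, hL]
  refine ENNReal.ofReal_le_ofReal ?_
  linarith [trace_correlation_le hA hB hK]

end Optimality

end GaussEOT

theorem mainTheorem4 {H : Type*} [NormedAddCommGroup H] [InnerProductSpace ℝ H] [CompleteSpace H]
    [SecondCountableTopology H] [MeasurableSpace H] [BorelSpace H]
    (A B : H →L[ℝ] H) (hA : GaussEOT.IsCovariance A) (hB : GaussEOT.IsCovariance B)
    (hAB : GaussEOT.Reachable A B)
    (G M : H →L[ℝ] H) (hG : GaussEOT.IsGreen A G) (hM : GaussEOT.IsGreen B M) :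
    -- the canonical pair `G₀ = A^{1/2}`, `M₀` consists of properly aligned Green's operators
    GaussEOT.IsGreen A (GaussEOT.opSqrt A) ∧
    GaussEOT.IsGreen B (GaussEOT.canonicalM A B) ∧
    GaussEOT.ProperlyAligned (GaussEOT.opSqrt A) (GaussEOT.canonicalM A B) ∧
    GaussEOT.IsTraceClass (GaussEOT.canonicalC A B) ∧
    ∃ R : ℝ → H →L[ℝ] H,
      -- `R ε` is the unique maximizer of the entropic profit; `C_ε = G (R ε) M*` is trace class
      (∀ ε : ℝ, 0 < ε →
        GaussEOT.IsOptimalCorrelation G M ε (R ε) ∧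
        (∀ R' : H →L[ℝ] H, GaussEOT.IsOptimalCorrelation G M ε R' → R' = R ε) ∧
        GaussEOT.IsTraceClass (G ∘L R ε ∘L M.adjoint)) ∧
      -- `C_ε → C₀` in trace norm
      Tendsto (fun ε : ℝ => GaussEOT.traceNorm (G ∘L R ε ∘L M.adjoint - GaussEOT.canonicalC A B))
        (𝓝[>] 0) (𝓝 0) ∧
      -- the Gaussian couplings converge in the 2-Wasserstein distance
      ∃ (π : ℝ → Measure (WithLp 2 (H × H))) (π₀ : Measure (WithLp 2 (H × H))),
        (∀ ε : ℝ, 0 < ε →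
          GaussEOT.IsCenteredGaussian (π ε)
            (GaussEOT.blockCov A (G ∘L R ε ∘L M.adjoint) B)) ∧
        GaussEOT.IsCenteredGaussian π₀ (GaussEOT.blockCov A (GaussEOT.canonicalC A B) B) ∧
        (∀ μ ν : Measure H, GaussEOT.IsCenteredGaussian μ A → GaussEOT.IsCenteredGaussian ν B →
          GaussEOT.IsOptimalCoupling μ ν (π₀.map WithLp.ofLp)) ∧
        Tendsto (fun ε : ℝ => GaussEOT.W2 (π ε) π₀) (𝓝[>] 0) (𝓝 0) := by
  refine ⟨GaussEOT.isGreen_opSqrt hA, GaussEOT.isGreen_canonicalM hA hB,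
    GaussEOT.properlyAligned_canonicalM hA hB, GaussEOT.isTraceClass_canonicalC hA hB, ?_⟩
  -- One singular basis of G*M serves every ε and the limit, so all the Gaussian series share an
  -- index set and can be driven by the same variables.
  obtain ⟨ι, f, l, h⟩ := GaussEOT.exists_isSingularBasis (G := G) hM.1
  obtain ⟨W, hW⟩ := h.exists_isLimitCorrelation
  -- For ε ≤ 0 the operator is set to 0; these values do not affect the limits from the right.
  have hex : ∀ ε : ℝ, ∃ R, 0 < ε → GaussEOT.IsShrunk G M f l ε R := fun ε => by
    by_cases hε : 0 < ε
    · obtain ⟨R, hR⟩ := GaussEOT.exists_isShrunk G M f l hε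
      exact ⟨R, fun _ => hR⟩
    · exact ⟨0, fun h0 => absurd h0 hε⟩
  choose R hR using hex
  have hC := hW.comp_eq_canonicalC hA hB hG hM
  have hπ₀ := hW.isCenteredGaussian hG hM
  rw [hC] at hπ₀
  refine ⟨R, fun ε hε => ⟨(hR ε hε).isOptimalCorrelation h hε hM.1,
    fun R' hR' => (hR ε hε).eq_of_isOptimalCorrelation h hε hM.1 hR',
    GaussEOT.isTraceClass_comp hG.1 (hM.1.adjoint.comp_left _)⟩, ?_,
    fun ε => GaussEOT.blockLaw G M (R ε) f (GaussEOT.defect l ε),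
    GaussEOT.blockLaw G M W f (GaussEOT.limitDefect l),
    fun ε hε => (hR ε hε).isCenteredGaussian h hε hG hM, hπ₀,
    fun μ ν hμ hν => GaussEOT.isOptimalCoupling_map_ofLp hA hB hπ₀ hμ hν,
    GaussEOT.tendsto_W2 h hW hG.1 hM.1 hR⟩
  rw [← hC]
  exact GaussEOT.tendsto_traceNorm h hW hG.1 hM.1 hR
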